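/- Let $\mathbb{K}=\mathbb{R}$ or $\mathbb{C}$, and let $\lambda_1,\dots,\lambda_n\in\mathbb{K}$ be non-resonant: $\sum_k \lambda_k j_k\neq 0$ for every $(j_1,\dots,j_n)\in\mathbb{Z}^n\setminus\{0\}$. Consider formal power series $H(x,y)=\sum_{l\ge 2}H_l(x,y)$ over $\mathbb{K}$ in $x_1,\dots,x_n,y_1,\dots,y_n$ (for example, convergent ones), where $H_l$ is homogeneous of degree $l$ and $H_2=\sum_{k=1}^n\lambda_k x_k y_k$. **Proposition 1.1.** (i) For every such $H$ there are a unique formal series $v(x,\eta)=\sum_{l\ge 2}v_l(x,\eta)$, with $v_l$ homogeneous of degree $l$ and $v_2=\sum_k x_k\eta_k$, a unique formal transformation $$x_k=\varphi_k(\xi,\eta)=\xi_k+\cdots,\qquad y_k=\psi_k(\xi,\eta)=\eta_k+\cdots$$ (the dots are terms of degree at least $2$), and a unique formal power series $K(\xi,\eta)$ without constant term, such that: - the transformation is the one generated by $v$, that is, $\xi_k=v_{\eta_k}(\varphi(\xi,\eta),\eta)$ and $\psi_k(\xi,\eta)=v_{x_k}(\varphi(\xi,\eta),\eta)$ for $k=1,\dots,n$;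 - in the variables $(\xi,\eta)$ the system $\dot x_k=H_{y_k}$, $\dot y_k=-H_{x_k}$ takes the form $\dot\xi_k=K_{\eta_k}$, $\dot\eta_k=-K_{\xi_k}$; - $K$ is a formal power series in the products $\omega_k=\xi_k\eta_k$, $k=1,\dots,n$; - the series $\Phi=\sum_{k=1}^n(\xi_k y_k-\eta_k x_k)$, expressed in the variables $(\xi,\eta)$, contains no monomial $\prod_k\omega_k^{\alpha_k}$. Moreover, this transformation is canonical (symplectic) and $K(\xi,\eta)=H(\varphi(\xi,\eta),\psi(\xi,\eta))$. (ii) For every $l\ge 2$, each coefficient of the degree-$l$ homogeneous part $K_l$ of $K$ and each coefficient of $v_l$ is a polynomial over $\mathbb{K}$, of degree at most $l-2$, in the coefficients of $H_3,\dots,H_l$. These polynomials depend only on $n$, on $\lambda_1,\dots,\lambda_n$ and on the monomial considered, and not on $H_3,H_4,\dots$. -/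

import Mathlib

/-! Formal power series in `2n` variables are `MvPowerSeries (Fin n ⊕ Fin n) 𝕜`. The index
`Sum.inl k` stands for the position variable `x_k` (or `ξ_k`), the index `Sum.inr k` for the
momentum variable `y_k` (or `η_k`). -/

noncomputable section

namespace BirkhoffNF

open MvPowerSeries

variable {𝕜 : Type*} [RCLike 𝕜] {n : ℕ}

/-- `lam_1, …, lam_n` are non-resonant: they satisfy no nontrivial linear relation over `ℤ`. -/
def NonResonant (lam : Fin n → 𝕜) : Prop :=
  ∀ j : Fin n → ℤ, ∑ k, lam k * (j k : 𝕜) = 0 → j = 0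

/-- `H = ∑_{l ≥ 2} H_l` with quadratic part `H_2 = ∑_k lam_k x_k y_k`. -/
structure HasDiagonalQuadraticPart (lam : Fin n → 𝕜)
    (H : MvPowerSeries (Fin n ⊕ Fin n) 𝕜) : Prop where
  deg_zero : homogeneousComponent 0 H = 0
  deg_one : homogeneousComponent 1 H = 0
  deg_two : homogeneousComponent 2 H = ∑ k, C (lam k) * X (Sum.inl k) * X (Sum.inr k)

/-- `v(x, η) = ∑_{l ≥ 2} v_l(x, η)` with `v_2 = ∑_k x_k η_k`. -/
structure IsGeneratingSeries (v : MvPowerSeries (Fin n ⊕ Fin n) 𝕜) : Prop where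
  deg_zero : homogeneousComponent 0 v = 0
  deg_one : homogeneousComponent 1 v = 0
  deg_two : homogeneousComponent 2 v = ∑ k, X (Sum.inl k) * X (Sum.inr k)

/-- `f(φ(ξ, η), ψ(ξ, η))`. It is only used for `φ`, `ψ` without constant terms. -/
def comp (f : MvPowerSeries (Fin n ⊕ Fin n) 𝕜)
    (φ ψ : Fin n → MvPowerSeries (Fin n ⊕ Fin n) 𝕜) : MvPowerSeries (Fin n ⊕ Fin n) 𝕜 :=
  subst (Sum.elim φ ψ) f

/-- The formal transformation `x = φ(ξ, η)`, `y = ψ(ξ, η)`, where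
`φ_k = ξ_k + (terms of degree ≥ 2)` and `ψ_k = η_k + (terms of degree ≥ 2)`, is defined by the
generating series `v(x, η)`, that is, by `ξ_k = v_{η_k}(x, η)` and `y_k = v_{x_k}(x, η)`. -/
structure IsGeneratedBy (v : MvPowerSeries (Fin n ⊕ Fin n) 𝕜)
    (φ ψ : Fin n → MvPowerSeries (Fin n ⊕ Fin n) 𝕜) : Prop where
  φ_zero : ∀ k, homogeneousComponent 0 (φ k) = 0
  φ_one : ∀ k, homogeneousComponent 1 (φ k) = X (Sum.inl k)
  ψ_zero : ∀ k, homogeneousComponent 0 (ψ k) = 0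
  ψ_one : ∀ k, homogeneousComponent 1 (ψ k) = X (Sum.inr k)
  position : ∀ k,
    X (Sum.inl k) = comp (pderiv 𝕜 (Sum.inr k) v) φ (fun j => X (Sum.inr j))
  momentum : ∀ k,
    ψ k = comp (pderiv 𝕜 (Sum.inl k) v) φ (fun j => X (Sum.inr j))

/-- The Poisson bracket `{f, g} = ∑_k (f_{ξ_k} g_{η_k} - f_{η_k} g_{ξ_k})`. -/
def poissonBracket (f g : MvPowerSeries (Fin n ⊕ Fin n) 𝕜) :
    MvPowerSeries (Fin n ⊕ Fin n) 𝕜 :=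
  ∑ k, (pderiv 𝕜 (Sum.inl k) f * pderiv 𝕜 (Sum.inr k) g
    - pderiv 𝕜 (Sum.inr k) f * pderiv 𝕜 (Sum.inl k) g)

/-- The formal transformation `x = φ(ξ, η)`, `y = ψ(ξ, η)` is canonical (symplectic). -/
structure IsCanonical (φ ψ : Fin n → MvPowerSeries (Fin n ⊕ Fin n) 𝕜) : Prop where
  φφ : ∀ i j, poissonBracket (φ i) (φ j) = 0
  ψψ : ∀ i j, poissonBracket (ψ i) (ψ j) = 0
  φψ : ∀ i j, poissonBracket (φ i) (ψ j) = if i = j then 1 else 0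

/-- The derivative of `f(ξ, η)` along the system `ξ'_j = K_{η_j}`, `η'_j = -K_{ξ_j}`. -/
def flowDeriv (K f : MvPowerSeries (Fin n ⊕ Fin n) 𝕜) : MvPowerSeries (Fin n ⊕ Fin n) 𝕜 :=
  ∑ j, (pderiv 𝕜 (Sum.inl j) f * pderiv 𝕜 (Sum.inr j) K
    + pderiv 𝕜 (Sum.inr j) f * (-pderiv 𝕜 (Sum.inl j) K))

/-- Under `x = φ(ξ, η)`, `y = ψ(ξ, η)`, the system `x'_k = H_{y_k}`, `y'_k = -H_{x_k}` takes the
form `ξ'_k = K_{η_k}`, `η'_k = -K_{ξ_k}`. (For a transformation tangent to the identity the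
Jacobian matrix is invertible, so these equations determine the vector field in the new
variables.) -/
structure TransformsSystem (H : MvPowerSeries (Fin n ⊕ Fin n) 𝕜)
    (φ ψ : Fin n → MvPowerSeries (Fin n ⊕ Fin n) 𝕜)
    (K : MvPowerSeries (Fin n ⊕ Fin n) 𝕜) : Prop where
  position : ∀ k, flowDeriv K (φ k) = comp (pderiv 𝕜 (Sum.inr k) H) φ ψ
  momentum : ∀ k, flowDeriv K (ψ k) = -comp (pderiv 𝕜 (Sum.inl k) H) φ ψ

/-- `K` is a formal power series in the products `ω_k = ξ_k η_k`. -/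
def IsSeriesInProducts (K : MvPowerSeries (Fin n ⊕ Fin n) 𝕜) : Prop :=
  ∃ F : MvPowerSeries (Fin n) 𝕜, K = subst
    (fun k => (X (Sum.inl k) * X (Sum.inr k) : MvPowerSeries (Fin n ⊕ Fin n) 𝕜)) F

/-- `f` contains no product of powers of the `ω_k = ξ_k η_k`. -/
def HasNoProducts (f : MvPowerSeries (Fin n ⊕ Fin n) 𝕜) : Prop :=
  ∀ m : (Fin n ⊕ Fin n) →₀ ℕ, (∀ k, m (Sum.inl k) = m (Sum.inr k)) → coeff m f = 0

/-- `Φ = ∑_k (ξ_k y_k - η_k x_k)`, expressed in the variables `(ξ, η)`. -/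
def normalizationSeries (φ ψ : Fin n → MvPowerSeries (Fin n ⊕ Fin n) 𝕜) :
    MvPowerSeries (Fin n ⊕ Fin n) 𝕜 :=
  ∑ k, (X (Sum.inl k) * ψ k - X (Sum.inr k) * φ k)

/-- `v` generates a formal transformation `(φ, ψ)`, normalized by the condition on `Φ`, that
brings the system with hamiltonian `H` to the system with hamiltonian `K`, and `K`, taken
without constant term, is a formal power series in the products `ω_k`. -/
structure IsBirkhoffNormalization (H v : MvPowerSeries (Fin n ⊕ Fin n) 𝕜)
    (φ ψ : Fin n → MvPowerSeries (Fin n ⊕ Fin n) 𝕜)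
    (K : MvPowerSeries (Fin n ⊕ Fin n) 𝕜) : Prop where
  generating : IsGeneratingSeries v
  generated : IsGeneratedBy v φ ψ
  transforms : TransformsSystem H φ ψ K
  constantCoeff_zero : constantCoeff K = 0
  inProducts : IsSeriesInProducts K
  normalized : HasNoProducts (normalizationSeries φ ψ)

/-- Exponents of the monomials that occur in the homogeneous parts of degrees `3, …, l`; they
label the coefficients of `H_3, …, H_l`. -/
abbrev CoeffIndex (n l : ℕ) : Type :=
  {j : (Fin n ⊕ Fin n) →₀ ℕ // 3 ≤ j.degree ∧ j.degree ≤ l}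

end BirkhoffNF

end

/-! Put `w = v - v_2` and let `U` collect `w`, `φ - ξ` and `ψ - η`. The generating equations say
that `φ - ξ` and `ψ - η` are, up to sign, first derivatives of `w` plus the corrections
`gradRemainder` caused by evaluating at `φ` instead of `ξ`. After insertion into `H(φ, ψ)` and `Φ`,
the part linear in `w` is diagonal on monomials: it multiplies the coefficient at `m` by `divisor
lam m` in `H(φ, ψ)` and by `m.degree` in `Φ`. Non-resonance makes the divisor nonzero unless the
monomial is a product of the `ω_k`. So the condition on `H(φ, ψ)` fixes the non-resonant
coefficients of `w`, the condition on `Φ` fixes the resonant ones, and together with the generating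
equations they say that `U` is a fixed point of `step` (`NonResonant.step_eq_iff`).

Give a coefficient of degree `d` the level `d - 2` in `w` and in `H`, and `d - 1` in `φ - ξ` and `ψ
- η`. The corrections are quadratic in `U` or involve the terms of `H` of positive level, so level
`k` of `step U` depends only on lower levels of `U`: there is exactly one fixed point. The same
count shows that a coefficient of level `k` is a polynomial of degree at most `k` in the
coefficients of `H_3, …, H_{k+2}`. `LevelFiltration` carries both arguments at once, through the
single estimate `LevelFiltration.mem_step`.

It remains to identify `K`. A generated transformation is canonical (`IsGeneratedBy.isCanonical`),
so `H(φ, ψ)` is a hamiltonian of the new system; the Jacobian matrix is invertible, so the gradient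
of any other `K` is the same (`IsGeneratedBy.eq_of_transformsSystem`). -/

noncomputable section

namespace BirkhoffNF

open MvPowerSeries

/-! ### Chain rule for substitution of formal power series. -/

section ChainRule

variable {σ τ R : Type*} [CommRing R]

theorem order_le_order_subst [Finite σ] {a : σ → MvPowerSeries τ R} (ha : ∀ i, constantCoeff (a i) = 0)
    (f : MvPowerSeries σ R) : f.order ≤ (subst a f).order := by
  refine le_trans ?_ (le_order_subst (hasSubst_of_constantCoeff_zero ha) f)
  refine le_mul_of_one_le_left' ?_
  exact le_iInf fun i => (one_le_order_iff_constCoeff_eq_zero).2 (ha i)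

theorem coeff_subst_eq_zero [Finite σ] {a : σ → MvPowerSeries τ R} (ha : ∀ i, constantCoeff (a i) = 0)
    {f : MvPowerSeries σ R} {N : ℕ} (hf : ∀ d : σ →₀ ℕ, d.degree < N → coeff d f = 0)
    {e : τ →₀ ℕ} (he : e.degree < N) : coeff e (subst a f) = 0 := by
  refine coeff_of_lt_order (lt_of_lt_of_le ?_ (order_le_order_subst ha f))
  exact lt_of_lt_of_le (by exact_mod_cast he) (nat_le_order hf)

theorem subst_sum {ι : Type*} {a : σ → MvPowerSeries τ R} (ha : HasSubst a) (s : Finset ι)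
    (f : ι → MvPowerSeries σ R) : subst a (∑ i ∈ s, f i) = ∑ i ∈ s, subst a (f i) := by
  simp_rw [← coe_substAlgHom ha, map_sum]

theorem subst_C' (a : σ → MvPowerSeries τ R) (r : R) :
    subst a (C r : MvPowerSeries σ R) = C r := by
  rw [← MvPolynomial.coe_C, subst_coe, MvPolynomial.aeval_C]
  rfl

theorem pderiv_aeval [Fintype σ] (a : σ → MvPowerSeries τ R) (p : MvPolynomial σ R) (i : τ) :
    pderiv R i (MvPolynomial.aeval a p) =
      ∑ j, MvPolynomial.aeval a (MvPolynomial.pderiv j p) * pderiv R i (a j) := by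
  classical
  induction p using MvPolynomial.induction_on with
  | C r => simp
  | add p q hp hq => simp [hp, hq, add_mul, Finset.sum_add_distrib]
  | mul_X p k hp =>
    have h : ∀ j, MvPolynomial.aeval a (MvPolynomial.pderiv j (p * MvPolynomial.X k)) *
        pderiv R i (a j) = MvPolynomial.aeval a (MvPolynomial.pderiv j p) * pderiv R i (a j) * a k +
          (if j = k then MvPolynomial.aeval a p * pderiv R i (a j) else 0) := by
      intro j
      rw [Derivation.leibniz, MvPolynomial.pderiv_X]
      by_cases hjk : j = k
      · subst hjk
        simp
        ring
      · simp [hjk, Ne.symm hjk]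
        ring
    simp_rw [h, Finset.sum_add_distrib, ← Finset.sum_mul, ← hp]
    simp
    ring

theorem pderiv_subst [Fintype σ] {a : σ → MvPowerSeries τ R}
    (ha : ∀ i, constantCoeff (a i) = 0) (f : MvPowerSeries σ R) (i : τ) :
    pderiv R i (subst a f) = ∑ j, subst a (pderiv R j f) * pderiv R i (a j) := by
  classical
  have hs := hasSubst_of_constantCoeff_zero ha
  ext e
  -- Differentiation lowers degrees by one, so the coefficient at `e` on either side sees only terms
  -- of `f` of degree at most `e.degree + 1`; the rest is the polynomial case.
  set p : MvPolynomial σ R := truncTotal (e.degree + 2) f with hp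
  obtain ⟨r, hr⟩ : ∃ r, f = (p : MvPowerSeries σ R) + r := ⟨f - p, by ring⟩
  have hr0 : ∀ d : σ →₀ ℕ, d.degree < e.degree + 2 → coeff d r = 0 := by
    intro d hd
    have : r = f - p := by rw [hr]; ring
    rw [this, map_sub, MvPolynomial.coeff_coe, hp, coeff_truncTotal _ hd, sub_self]
  have h1 : coeff e (pderiv R i (subst a r)) = 0 := by
    rw [coeff_pderiv, coeff_subst_eq_zero ha hr0 (by simp), zero_mul]
  have h2 : coeff e (∑ j, subst a (pderiv R j r) * pderiv R i (a j)) = 0 := by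
    rw [map_sum]
    refine Finset.sum_eq_zero fun j _ => ?_
    rw [coeff_mul]
    refine Finset.sum_eq_zero fun q hq => ?_
    rw [coeff_subst_eq_zero ha (N := e.degree + 1), zero_mul]
    · intro d hd
      rw [coeff_pderiv, hr0 _ (by simpa using hd), zero_mul]
    · rw [← Finset.HasAntidiagonal.mem_antidiagonal.1 hq, map_add]
      omega
  have h3 : pderiv R i (subst a (p : MvPowerSeries σ R)) =
      ∑ j, subst a (pderiv R j (p : MvPowerSeries σ R)) * pderiv R i (a j) := by
    simp_rw [pderiv_coe, subst_coe, pderiv_aeval]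
  rw [hr, subst_add hs, map_add, map_add, h1, h3]
  simp_rw [map_add (pderiv R _), subst_add hs, add_mul, Finset.sum_add_distrib]
  rw [map_add, h2]

end ChainRule

/-! ### Filtrations by level and their stability under the operations on power series. -/

/-- A family of filtrations (indexed by an integer level) of the functions `S → 𝕜`. The members
of `toFun i k` are the admissible values, for coefficients of level `k`, of `S`-families of power
series; `i` measures how much the family gains over the basic filtration. -/
structure LevelFiltration (𝕜 S : Type*) [Field 𝕜] where
  toFun : ℕ → ℤ → Submodule 𝕜 (S → 𝕜)
  neg' : ∀ {i k} {c : S → 𝕜}, k < 0 → c ∈ toFun i k → c = 0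
  anti' : ∀ {i k}, toFun (i + 1) k ≤ toFun i k
  one' : (1 : S → 𝕜) ∈ toFun 0 0
  mul' : ∀ {i j k l} {c d : S → 𝕜}, i + j ≤ 2 → c ∈ toFun i k → d ∈ toFun j l →
    c * d ∈ toFun (i + j) (k + l)

namespace LevelFiltration

variable {𝕜 S σ τ : Type*} [Field 𝕜] (F : LevelFiltration 𝕜 S)

/-- The coefficients of degree `k + s` of the family `f` lie in level `k` of the filtration. -/
def Mem (i : ℕ) (s : ℤ) (f : S → MvPowerSeries σ 𝕜) : Prop :=
  ∀ m : σ →₀ ℕ, (fun t => coeff m (f t)) ∈ F.toFun i (m.degree - s)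

variable {F} {i j : ℕ} {s s' : ℤ} {f g : S → MvPowerSeries σ 𝕜}

theorem Mem.zero : F.Mem i s (fun _ => (0 : MvPowerSeries σ 𝕜)) := fun m => by
  convert (F.toFun i (m.degree - s)).zero_mem using 1
  ext t
  simp

theorem Mem.add (hf : F.Mem i s f) (hg : F.Mem i s g) : F.Mem i s (fun t => f t + g t) :=
  fun m => by
  convert (F.toFun i (m.degree - s)).add_mem (hf m) (hg m) using 1
  ext t
  simp

theorem Mem.sub (hf : F.Mem i s f) (hg : F.Mem i s g) : F.Mem i s (fun t => f t - g t) :=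
  fun m => by
  convert (F.toFun i (m.degree - s)).sub_mem (hf m) (hg m) using 1
  ext t
  simp

theorem Mem.neg (hf : F.Mem i s f) : F.Mem i s (fun t => -f t) :=
  fun m => by
  convert (F.toFun i (m.degree - s)).neg_mem (hf m) using 1
  ext t
  simp

theorem Mem.C_mul (r : 𝕜) (hf : F.Mem i s f) : F.Mem i s (fun t => C r * f t) :=
  fun m => by
  convert (F.toFun i (m.degree - s)).smul_mem r (hf m) using 1
  ext t
  simp

theorem Mem.sum {ι : Type*} (u : Finset ι) {f : ι → S → MvPowerSeries σ 𝕜}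
    (hf : ∀ k ∈ u, F.Mem i s (f k)) : F.Mem i s (fun t => ∑ k ∈ u, f k t) := fun m => by
  have := (F.toFun i (m.degree - s)).sum_mem (fun k hk => hf k hk m)
  convert this using 1
  ext t
  simp

theorem Mem.of_succ (hf : F.Mem (i + 1) s f) : F.Mem i s f := fun m => F.anti' (hf m)

theorem Mem.zero_le (hf : F.Mem i s f) : F.Mem 0 s f := by
  induction i with
  | zero => exact hf
  | succ i ih => exact ih hf.of_succ

theorem Mem.coeff_eq_zero (hf : F.Mem i s f) {m : σ →₀ ℕ} (hm : (m.degree : ℤ) < s) (t : S) :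
    coeff m (f t) = 0 :=
  congrFun (F.neg' (by omega) (hf m)) t

theorem Mem.mul (hf : F.Mem i s f) (hg : F.Mem j s' g) (hij : i + j ≤ 2) :
    F.Mem (i + j) (s + s') (fun t => f t * g t) := fun m => by
  classical
  have := (F.toFun (i + j) (m.degree - (s + s'))).sum_mem
    (t := Finset.HasAntidiagonal.antidiagonal m)
    (f := fun q t => coeff q.1 (f t) * coeff q.2 (g t)) (fun q hq => by
      have h := F.mul' hij (hf q.1) (hg q.2)
      convert! h using 2
      rw [← Finset.HasAntidiagonal.mem_antidiagonal.1 hq, map_add]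
      push_cast
      ring)
  convert this using 1
  ext t
  simp [coeff_mul]

theorem Mem.one : F.Mem 0 0 (fun _ => (1 : MvPowerSeries σ 𝕜)) := fun m => by
  classical
  by_cases hm : m = 0
  · subst hm
    simpa using! F.one'
  · convert (F.toFun 0 (m.degree - 0)).zero_mem using 1
    ext t
    simp [coeff_one, hm]

theorem Mem.X (k : σ) : F.Mem 0 1 (fun _ => (X k : MvPowerSeries σ 𝕜)) := fun m => by
  classical
  by_cases hm : m = Finsupp.single k 1
  · subst hm
    simpa [coeff_X] using! F.one'
  · convert (F.toFun 0 (m.degree - 1)).zero_mem using 1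
    ext t
    simp [coeff_X, hm]

theorem Mem.pderiv (hf : F.Mem i s f) (k : σ) : F.Mem i (s - 1) (fun t => pderiv 𝕜 k (f t)) :=
  fun m => by
  have := (F.toFun i (m.degree - (s - 1))).smul_mem ((m k : 𝕜) + 1)
    (x := fun t => coeff (m + Finsupp.single k 1) (f t)) (by
      convert hf (m + Finsupp.single k 1) using 2
      simp
      ring)
  convert this using 1
  ext t
  simp [coeff_pderiv, mul_comm]

theorem Mem.X_mul (hf : F.Mem i s f) (hi : i ≤ 2) (k : σ) :
    F.Mem i (s + 1) (fun t => MvPowerSeries.X k * f t) := by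
  have := (Mem.X (F := F) k).mul hf (by omega)
  rwa [zero_add, add_comm] at this

theorem Mem.constantCoeff_eq_zero (hf : F.Mem i 1 f) (t : S) : constantCoeff (f t) = 0 := by
  rw [← coeff_zero_eq_constantCoeff_apply]
  exact hf.coeff_eq_zero (by simp) t

variable {a b : S → σ → MvPowerSeries τ 𝕜}

theorem Mem.monomial (ha : ∀ k, F.Mem 0 1 (fun t => a t k)) (d : σ →₀ ℕ) :
    F.Mem 0 d.degree (fun t => d.prod fun k e => a t k ^ e) := by
  classical
  induction d using Finsupp.induction_linear with
  | zero => simpa using Mem.one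
  | add d d' hd hd' =>
    have := hd.mul hd' (by omega)
    simpa [Finsupp.prod_add_index', pow_add] using this
  | single k e =>
    simp only [pow_zero, Finsupp.prod_single_index, Finsupp.degree_single]
    induction e with
    | zero => simpa using Mem.one
    | succ e ih => simpa [pow_succ] using ih.mul (ha k) (by omega)

/-- Telescoping: `a a' - b b' = (a - b) b' + a (a' - b')` keeps the index of the difference. -/
theorem Mem.monomial_sub (hj : j ≤ 2) (ha : ∀ k, F.Mem 0 1 (fun t => a t k))
    (hb : ∀ k, F.Mem 0 1 (fun t => b t k)) (hab : ∀ k, F.Mem j 1 (fun t => a t k - b t k))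
    (d : σ →₀ ℕ) :
    F.Mem j d.degree
      (fun t => (d.prod fun k e => a t k ^ e) - d.prod fun k e => b t k ^ e) := by
  classical
  induction d using Finsupp.induction_linear with
  | zero => simpa using Mem.zero
  | add d d' hd hd' =>
    have h1 := hd.mul (Mem.monomial hb d') (by omega)
    have h2 := (Mem.monomial ha d).mul hd' (by omega)
    rw [add_zero] at h1
    rw [zero_add] at h2
    have := h1.add h2
    simp only [Finsupp.prod_add_index', pow_add, pow_zero, implies_true, map_add, Nat.cast_add]
    convert this using 2
    ring
  | single k e =>
    simp only [pow_zero, Finsupp.prod_single_index, Finsupp.degree_single]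
    have hp : ∀ {c : S → σ → MvPowerSeries τ 𝕜}, (∀ k, F.Mem 0 1 (fun t => c t k)) →
        ∀ e : ℕ, F.Mem 0 (e : ℤ) (fun t => c t k ^ e) := fun hc e => by
      simpa using Mem.monomial hc (Finsupp.single k e)
    induction e with
    | zero => simpa using Mem.zero
    | succ e ih =>
      have h1 := ih.mul (hb k) (by omega)
      have h2 := (hp ha e).mul (hab k) (by omega)
      rw [add_zero] at h1
      rw [zero_add] at h2
      have := h1.add h2
      push_cast
      convert this using 2
      ring

/-- As `g d` starts in degree `d.degree`, finitely many `d` contribute to each coefficient, and in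
each term the levels of the two factors add up to the required one. -/
theorem Mem.of_finsum [Finite σ] (hij : i + j ≤ 2) (hf : F.Mem i s f)
    {g : (σ →₀ ℕ) → S → MvPowerSeries τ 𝕜} (hg : ∀ d, F.Mem j d.degree (g d))
    {h : S → MvPowerSeries τ 𝕜}
    (hh : ∀ t m, coeff m (h t) = finsum fun d => coeff d (f t) * coeff m (g d t)) :
    F.Mem (i + j) s h := fun m => by
  have hfin := Finsupp.finite_of_degree_le (σ := σ) m.degree
  have := (F.toFun (i + j) (m.degree - s)).sum_mem (t := hfin.toFinset)
    (f := fun d t => coeff d (f t) * coeff m (g d t)) (fun d _ => by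
      have h := F.mul' hij (hf d) (hg d m)
      convert! h using 2
      ring)
  convert this using 1
  ext t
  rw [hh, finsum_eq_sum_of_support_subset (s := hfin.toFinset), Finset.sum_apply]
  intro d hd
  by_contra hd'
  simp only [Set.Finite.coe_toFinset, Set.mem_ofPred_eq, not_le] at hd'
  exact hd (mul_eq_zero_of_right _ ((hg d).coeff_eq_zero (by exact_mod_cast hd') t))

theorem hasSubst_of_mem [Finite σ] (ha : ∀ k, F.Mem i 1 (fun t => a t k)) (t : S) :
    HasSubst (a t) :=
  hasSubst_of_constantCoeff_zero fun k => (ha k).constantCoeff_eq_zero t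

theorem Mem.subst [Finite σ] (hi : i ≤ 2) (hf : F.Mem i s f)
    (ha : ∀ k, F.Mem 0 1 (fun t => a t k)) : F.Mem i s (fun t => subst (a t) (f t)) :=
  Mem.of_finsum (j := 0) (by omega) hf (Mem.monomial ha) fun t m => by
    simp [coeff_subst (hasSubst_of_mem ha t)]

/-- The source of the contraction: the index of the change of argument is added to that of `f`. -/
theorem Mem.subst_sub [Finite σ] (hij : i + j ≤ 2) (hf : F.Mem i s f)
    (ha : ∀ k, F.Mem 0 1 (fun t => a t k)) (hb : ∀ k, F.Mem 0 1 (fun t => b t k))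
    (hab : ∀ k, F.Mem j 1 (fun t => a t k - b t k)) :
    F.Mem (i + j) s (fun t => MvPowerSeries.subst (a t) (f t) - MvPowerSeries.subst (b t) (f t)) :=
  Mem.of_finsum hij hf (Mem.monomial_sub (by omega) ha hb hab) fun t m => by
    rw [map_sub, coeff_subst (hasSubst_of_mem ha t), coeff_subst (hasSubst_of_mem hb t),
      ← finsum_sub_distrib (coeff_subst_finite (hasSubst_of_mem ha t) _ _)
        (coeff_subst_finite (hasSubst_of_mem hb t) _ _)]
    simp [mul_sub]

end LevelFiltration

/-! ### The fixed-point operator and its level estimate. -/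

section Operator

variable {𝕜 : Type*} [RCLike 𝕜] {n : ℕ}

/-- The degree of the terms of level zero: a family `U` indexed by `Option (Fin n ⊕ Fin n)` holds
in `U none` the series `v - v_2`, and in `U (some j)` the deviation of the transformation from
the identity. -/
def shift : Option (Fin n ⊕ Fin n) → ℤ
  | none => 2
  | some _ => 1

/-- The arguments `(φ(ξ, η), η)`. -/
def mixedArg (U : Option (Fin n ⊕ Fin n) → MvPowerSeries (Fin n ⊕ Fin n) 𝕜) :
    Fin n ⊕ Fin n → MvPowerSeries (Fin n ⊕ Fin n) 𝕜 :=
  Sum.elim (fun k => X (Sum.inl k) + U (some (Sum.inl k))) (fun k => X (Sum.inr k))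

/-- The arguments `(φ(ξ, η), ψ(ξ, η))`. -/
def fullArg (U : Option (Fin n ⊕ Fin n) → MvPowerSeries (Fin n ⊕ Fin n) 𝕜) :
    Fin n ⊕ Fin n → MvPowerSeries (Fin n ⊕ Fin n) 𝕜 :=
  fun j => X j + U (some j)

/-- The effect on the `j`-th derivative of `v - v_2` of replacing `ξ` by `φ(ξ, η)`. -/
def gradRemainder (U : Option (Fin n ⊕ Fin n) → MvPowerSeries (Fin n ⊕ Fin n) 𝕜)
    (j : Fin n ⊕ Fin n) : MvPowerSeries (Fin n ⊕ Fin n) 𝕜 :=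
  subst (mixedArg U) (pderiv 𝕜 j (U none)) - pderiv 𝕜 j (U none)

/-- The part of the transformed hamiltonian that is not linear in `v - v_2`. -/
def energyRemainder (lam : Fin n → 𝕜) (G : MvPowerSeries (Fin n ⊕ Fin n) 𝕜)
    (U : Option (Fin n ⊕ Fin n) → MvPowerSeries (Fin n ⊕ Fin n) 𝕜) :
    MvPowerSeries (Fin n ⊕ Fin n) 𝕜 :=
  ∑ k, C (lam k) * (X (Sum.inl k) * gradRemainder U (Sum.inl k)
    - X (Sum.inr k) * gradRemainder U (Sum.inr k)
    + U (some (Sum.inl k)) * U (some (Sum.inr k))) + subst (fullArg U) G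

/-- The part of `Φ` that is not linear in `v - v_2`. -/
def normRemainder (U : Option (Fin n ⊕ Fin n) → MvPowerSeries (Fin n ⊕ Fin n) 𝕜) :
    MvPowerSeries (Fin n ⊕ Fin n) 𝕜 :=
  ∑ k, (X (Sum.inl k) * gradRemainder U (Sum.inl k)
    + X (Sum.inr k) * gradRemainder U (Sum.inr k))

/-- The monomial with exponents `m` is a product of powers of the `ω_k`. -/
def IsResonant (m : (Fin n ⊕ Fin n) →₀ ℕ) : Prop := ∀ k, m (Sum.inl k) = m (Sum.inr k)

/-- The small divisor of the monomial with exponents `m`. -/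
def divisor (lam : Fin n → 𝕜) (m : (Fin n ⊕ Fin n) →₀ ℕ) : 𝕜 :=
  ∑ k, lam k * ((m (Sum.inl k) : 𝕜) - m (Sum.inr k))

open Classical in
/-- The solution `w` of the homological equation. -/
def newSeries (lam : Fin n → 𝕜) (G : MvPowerSeries (Fin n ⊕ Fin n) 𝕜)
    (U : Option (Fin n ⊕ Fin n) → MvPowerSeries (Fin n ⊕ Fin n) 𝕜) :
    MvPowerSeries (Fin n ⊕ Fin n) 𝕜 :=
  fun m => if IsResonant m then -(m.degree : 𝕜)⁻¹ * coeff m (normRemainder U)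
    else -(divisor lam m)⁻¹ * coeff m (energyRemainder lam G U)

open Classical in
theorem coeff_newSeries (lam : Fin n → 𝕜) (G : MvPowerSeries (Fin n ⊕ Fin n) 𝕜)
    (U : Option (Fin n ⊕ Fin n) → MvPowerSeries (Fin n ⊕ Fin n) 𝕜) (m : (Fin n ⊕ Fin n) →₀ ℕ) :
    coeff m (newSeries lam G U) =
      if IsResonant m then -(m.degree : 𝕜)⁻¹ * coeff m (normRemainder U)
      else -(divisor lam m)⁻¹ * coeff m (energyRemainder lam G U) := rfl

/-- The operator whose fixed points are the normalizing transformations. -/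
def step (lam : Fin n → 𝕜) (G : MvPowerSeries (Fin n ⊕ Fin n) 𝕜)
    (U : Option (Fin n ⊕ Fin n) → MvPowerSeries (Fin n ⊕ Fin n) 𝕜) :
    Option (Fin n ⊕ Fin n) → MvPowerSeries (Fin n ⊕ Fin n) 𝕜
  | none => newSeries lam G U
  | some (Sum.inl k) => -(pderiv 𝕜 (Sum.inr k) (newSeries lam G U) + gradRemainder U (Sum.inr k))
  | some (Sum.inr k) => pderiv 𝕜 (Sum.inl k) (newSeries lam G U) + gradRemainder U (Sum.inl k)

namespace LevelFiltration

variable {S : Type*} {F : LevelFiltration 𝕜 S}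
  {U : S → Option (Fin n ⊕ Fin n) → MvPowerSeries (Fin n ⊕ Fin n) 𝕜}
  {G : S → MvPowerSeries (Fin n ⊕ Fin n) 𝕜}

theorem mem_mixedArg (hU : ∀ o, F.Mem 1 (shift o) (fun t => U t o)) (j : Fin n ⊕ Fin n) :
    F.Mem 0 1 (fun t => mixedArg (U t) j) := by
  cases j with
  | inl k => exact (Mem.X _).add (hU (some (Sum.inl k))).of_succ
  | inr k => exact Mem.X _

theorem mem_fullArg (hU : ∀ o, F.Mem 1 (shift o) (fun t => U t o)) (j : Fin n ⊕ Fin n) :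
    F.Mem 0 1 (fun t => fullArg (U t) j) :=
  (Mem.X _).add (hU (some j)).of_succ

/-- The derivative of `w` and the displacement `φ - ξ` both have index 1, so this term, quadratic in
`U`, has index 2. -/
theorem mem_gradRemainder (hU : ∀ o, F.Mem 1 (shift o) (fun t => U t o)) (j : Fin n ⊕ Fin n) :
    F.Mem 2 1 (fun t => gradRemainder (U t) j) := by
  have hw : F.Mem 1 1 (fun t => pderiv 𝕜 j (U t none)) := (hU none).pderiv j
  have := hw.subst_sub (j := 1) (by omega) (mem_mixedArg hU) (b := fun _ => X) (fun k => Mem.X k)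
    (fun k => ?_)
  · simpa [gradRemainder, subst_self] using this
  · cases k with
    | inl k => simpa [mixedArg, shift] using hU (some (Sum.inl k))
    | inr k => simpa [mixedArg] using Mem.zero

/-- Compare with the identity substitution: `G(φ, ψ) - G(ξ, η)` gains by `subst_sub`, and `G` itself
already has index 2. -/
theorem mem_subst_fullArg (hU : ∀ o, F.Mem 1 (shift o) (fun t => U t o)) (hG : F.Mem 2 2 G) :
    F.Mem 2 2 (fun t => subst (fullArg (U t)) (G t)) := by
  have := (hG.of_succ.subst_sub (j := 1) (by omega) (mem_fullArg hU) (b := fun _ => X)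
    (fun k => Mem.X k) (fun k => by simpa [fullArg, shift] using hU (some k))).add hG
  simpa [subst_self] using this

theorem mem_energyRemainder (lam : Fin n → 𝕜) (hU : ∀ o, F.Mem 1 (shift o) (fun t => U t o))
    (hG : F.Mem 2 2 G) : F.Mem 2 2 (fun t => energyRemainder lam (G t) (U t)) := by
  refine (Mem.sum _ fun k _ => Mem.C_mul _ ?_).add (mem_subst_fullArg hU hG)
  refine (((mem_gradRemainder hU _).X_mul (by omega) _).sub
    ((mem_gradRemainder hU _).X_mul (by omega) _)).add ?_
  exact (hU (some (Sum.inl k))).mul (hU (some (Sum.inr k))) (by omega)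

theorem mem_normRemainder (hU : ∀ o, F.Mem 1 (shift o) (fun t => U t o)) :
    F.Mem 2 2 (fun t => normRemainder (U t)) :=
  Mem.sum _ fun k _ => ((mem_gradRemainder hU _).X_mul (by omega) _).add
    ((mem_gradRemainder hU _).X_mul (by omega) _)

theorem mem_newSeries (lam : Fin n → 𝕜) (hU : ∀ o, F.Mem 1 (shift o) (fun t => U t o))
    (hG : F.Mem 2 2 G) : F.Mem 2 2 (fun t => newSeries lam (G t) (U t)) := fun m => by
  by_cases hm : IsResonant m
  · simp only [coeff_newSeries, if_pos hm]
    exact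
      (F.toFun _ _).smul_mem (-(m.degree : 𝕜)⁻¹) (mem_normRemainder hU m)
  · simp only [coeff_newSeries, if_neg hm]
    exact
      (F.toFun _ _).smul_mem (-(divisor lam m)⁻¹) (mem_energyRemainder lam hU hG m)

/-- The passage from index 1 to index 2 is the contraction when `F` is `agreement`, and the degree
bound when `F` is `polynomiality`. -/
theorem mem_step (lam : Fin n → 𝕜) (hU : ∀ o, F.Mem 1 (shift o) (fun t => U t o))
    (hG : F.Mem 2 2 G) (o : Option (Fin n ⊕ Fin n)) :
    F.Mem 2 (shift o) (fun t => step lam (G t) (U t) o) := by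
  have hw := mem_newSeries lam hU hG
  match o with
  | none => exact hw
  | some (Sum.inl k) => exact ((hw.pderiv _).add (mem_gradRemainder hU _)).neg
  | some (Sum.inr k) => exact (hw.pderiv _).add (mem_gradRemainder hU _)

end LevelFiltration

/-- The filtration that compares two families, which vanish at level `≤ 0`, below a level. -/
def agreement (𝕜 : Type*) [Field 𝕜] (M : ℕ) : LevelFiltration 𝕜 Bool where
  toFun i k :=
    { carrier := {c | (k < (min i 1 : ℕ) → c = 0) ∧ (k < M + (max i 1 : ℕ) → c true = c false)}
      add_mem' := fun {a b} ha hb => ⟨fun h => by simp [ha.1 h, hb.1 h],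
        fun h => by simp [ha.2 h, hb.2 h]⟩
      zero_mem' := ⟨fun _ => rfl, fun _ => rfl⟩
      smul_mem' := fun r a ha => ⟨fun h => by simp [ha.1 h], fun h => by simp [ha.2 h]⟩ }
  neg' := fun hk hc => hc.1 (by omega)
  anti' := fun hc => ⟨fun h => hc.1 (by omega), fun h => hc.2 (by omega)⟩
  one' := ⟨fun h => by simp at h, fun _ => rfl⟩
  mul' := fun {i j k l c d} hij hc hd => by
    by_cases hk : k < (min i 1 : ℕ)
    · rw [hc.1 hk, zero_mul]
      exact ⟨fun _ => rfl, fun _ => rfl⟩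
    by_cases hl : l < (min j 1 : ℕ)
    · rw [hd.1 hl, mul_zero]
      exact ⟨fun _ => rfl, fun _ => rfl⟩
    -- For `i = j = 1` both levels are now at least 1, so a sum below `M + 2` forces each below `M +
    -- 1`, where the factors agree. This is the one-level gain.
    refine ⟨fun h => by omega, fun h => ?_⟩
    simp only [Pi.mul_apply]
    rw [hc.2 (by omega), hd.2 (by omega)]

end Operator

/-! ### Existence and uniqueness of the fixed point. -/

section FixedPoint

variable {𝕜 : Type*} [RCLike 𝕜] {n : ℕ} {lam : Fin n → 𝕜} {G : MvPowerSeries (Fin n ⊕ Fin n) 𝕜}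
  {U V W : Option (Fin n ⊕ Fin n) → MvPowerSeries (Fin n ⊕ Fin n) 𝕜} {M : ℕ}

/-- All the components of `U` have terms of positive level only. -/
def Vanishes (U : Option (Fin n ⊕ Fin n) → MvPowerSeries (Fin n ⊕ Fin n) 𝕜) : Prop :=
  ∀ o m, (m.degree : ℤ) - shift o < 1 → coeff m (U o) = 0

/-- `U` and `V` have terms of positive level only, and the same terms up to level `M`. -/
structure Agree (M : ℕ) (U V : Option (Fin n ⊕ Fin n) → MvPowerSeries (Fin n ⊕ Fin n) 𝕜) :
    Prop where
  left : Vanishes U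
  right : Vanishes V
  eq : ∀ o m, (m.degree : ℤ) - shift o < M + 1 → coeff m (U o) = coeff m (V o)

theorem Vanishes.agree (hU : Vanishes U) (hV : Vanishes V) : Agree 0 U V :=
  ⟨hU, hV, fun o m h => by rw [hU o m (by omega), hV o m (by omega)]⟩

theorem Agree.trans (h : Agree M U V) (h' : Agree M V W) : Agree M U W :=
  ⟨h.left, h'.right, fun o m hm => (h.eq o m hm).trans (h'.eq o m hm)⟩

theorem Agree.symm (h : Agree M U V) : Agree M V U :=
  ⟨h.right, h.left, fun o m hm => (h.eq o m hm).symm⟩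

theorem Agree.mono {L : ℕ} (h : Agree M U V) (hL : L ≤ M) : Agree L U V :=
  ⟨h.left, h.right, fun o m hm => h.eq o m (by omega)⟩

theorem eq_of_agree (h : ∀ M, Agree M U V) : U = V :=
  funext fun o => MvPowerSeries.ext fun m => (h (m.degree + 2)).eq o m (by
    cases o <;> simp [shift] <;> omega)

theorem Agree.mem (h : Agree M U V) (o : Option (Fin n ⊕ Fin n)) :
    (agreement 𝕜 M).Mem 1 (shift o) (fun t => (cond t U V : _) o) := fun m =>
  ⟨fun hm => funext fun t => by
    cases t
    · exact h.right o m hm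
    · exact h.left o m hm, fun hm => h.eq o m hm⟩

theorem Agree.step (lam : Fin n → 𝕜) (hG : ∀ m, m.degree < 3 → coeff m G = 0)
    (h : Agree M U V) : Agree (M + 1) (step lam G U) (step lam G V) := by
  have key := LevelFiltration.mem_step (G := fun _ => G) lam h.mem fun m =>
    ⟨fun hm => funext fun _ => hG m (by simp at hm; omega), fun _ => rfl⟩
  exact ⟨fun o m hm => congrFun ((key o m).1 (by simpa using hm)) true,
    fun o m hm => congrFun ((key o m).1 (by simpa using hm)) false,
    fun o m hm => (key o m).2 (by simp at hm ⊢; omega)⟩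

theorem vanishes_zero :
    Vanishes (0 : Option (Fin n ⊕ Fin n) → MvPowerSeries (Fin n ⊕ Fin n) 𝕜) :=
  fun _ _ _ => rfl

theorem eq_of_step_eq (lam : Fin n → 𝕜) (hG : ∀ m, m.degree < 3 → coeff m G = 0)
    (hU : Vanishes U) (hV : Vanishes V) (hU' : step lam G U = U) (hV' : step lam G V = V) :
    U = V := by
  refine eq_of_agree fun M => ?_
  induction M with
  | zero => exact hU.agree hV
  | succ M ih => simpa [hU', hV'] using ih.step lam hG

theorem agree_iterate_succ (lam : Fin n → 𝕜) (hG : ∀ m, m.degree < 3 → coeff m G = 0) (k : ℕ) :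
    Agree k ((step lam G)^[k] 0) ((step lam G)^[k + 1] 0) := by
  induction k with
  | zero =>
    exact vanishes_zero.agree ((vanishes_zero.agree vanishes_zero).step lam hG).left
  | succ k ih =>
    simp only [Function.iterate_succ_apply'] at ih ⊢
    exact ih.step lam hG

theorem agree_iterate (lam : Fin n → 𝕜) (hG : ∀ m, m.degree < 3 → coeff m G = 0) {k l : ℕ}
    (hkl : k ≤ l) : Agree k ((step lam G)^[k] 0) ((step lam G)^[l] 0) := by
  induction l, hkl using Nat.le_induction with
  | base => exact ⟨(agree_iterate_succ lam hG k).left, (agree_iterate_succ lam hG k).left,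
      fun _ _ _ => rfl⟩
  | succ l hl ih => exact ih.trans ((agree_iterate_succ lam hG l).mono hl)

/-- The fixed point of `step`, as the limit of the iterates. -/
def solution (lam : Fin n → 𝕜) (G : MvPowerSeries (Fin n ⊕ Fin n) 𝕜) :
    Option (Fin n ⊕ Fin n) → MvPowerSeries (Fin n ⊕ Fin n) 𝕜 :=
  fun o m => coeff m ((step lam G)^[m.degree + 1] 0 o)

theorem coeff_solution (lam : Fin n → 𝕜) (G : MvPowerSeries (Fin n ⊕ Fin n) 𝕜)
    (o : Option (Fin n ⊕ Fin n)) (m : (Fin n ⊕ Fin n) →₀ ℕ) :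
    coeff m (solution lam G o) = coeff m ((step lam G)^[m.degree + 1] 0 o) := rfl

theorem agree_solution (lam : Fin n → 𝕜) (hG : ∀ m, m.degree < 3 → coeff m G = 0) (k : ℕ) :
    Agree k ((step lam G)^[k] 0) (solution lam G) := by
  refine ⟨(agree_iterate lam hG le_rfl).left, fun o m hm => ?_, fun o m hm => ?_⟩
  · rw [coeff_solution]
    exact (agree_iterate lam hG le_rfl).left o m hm
  · rw [coeff_solution]
    rcases le_total k (m.degree + 1) with hk | hk
    · exact (agree_iterate lam hG hk).eq o m hm
    -- The level of `m` is at most `m.degree - 1`, well within the range where the iterate `m.degree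
    -- + 1` is stationary.
    · refine ((agree_iterate lam hG hk).eq o m ?_).symm
      cases o <;> simp [shift] <;> omega

theorem vanishes_solution (lam : Fin n → 𝕜) (hG : ∀ m, m.degree < 3 → coeff m G = 0) :
    Vanishes (solution lam G) :=
  (agree_solution lam hG 0).right

theorem step_solution (lam : Fin n → 𝕜) (hG : ∀ m, m.degree < 3 → coeff m G = 0) :
    step lam G (solution lam G) = solution lam G := by
  refine eq_of_agree fun M => ?_
  have h1 := (agree_solution lam hG M).step lam hG
  rw [← Function.iterate_succ_apply' (step lam G)] at h1
  exact (h1.symm.trans (agree_solution lam hG (M + 1))).mono (Nat.le_succ M)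

end FixedPoint

/-! ### Polynomial dependence on the coefficients of the hamiltonian. -/

section Polynomiality

variable {𝕜 : Type*} [RCLike 𝕜] {n : ℕ} {S : Type*}

/-- The functions of `t` that are polynomials of degree at most `k` in the coefficients of the
homogeneous parts of degrees `3, …, k + 2` of `H t`. -/
def IsPolynomialIn (H : S → MvPowerSeries (Fin n ⊕ Fin n) 𝕜) (k : ℕ) (c : S → 𝕜) : Prop :=
  ∃ P : MvPolynomial (CoeffIndex n (k + 2)) 𝕜, P.totalDegree ≤ k ∧
    ∀ t, c t = MvPolynomial.eval (fun j => coeff j.1 (H t)) P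

theorem IsPolynomialIn.exists_le {H : S → MvPowerSeries (Fin n ⊕ Fin n) 𝕜} {k l : ℕ} {c : S → 𝕜}
    (hc : IsPolynomialIn H k c) (hkl : k ≤ l) :
    ∃ P : MvPolynomial (CoeffIndex n (l + 2)) 𝕜, P.totalDegree ≤ k ∧
      ∀ t, c t = MvPolynomial.eval (fun j => coeff j.1 (H t)) P := by
  obtain ⟨P, hP, h⟩ := hc
  refine ⟨MvPolynomial.rename (fun j => ⟨j.1, j.2.1, by have := j.2.2; omega⟩) P,
    (MvPolynomial.totalDegree_rename_le _ _).trans hP, fun t => ?_⟩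
  rw [h, MvPolynomial.eval_rename]
  rfl

theorem IsPolynomialIn.mul {H : S → MvPowerSeries (Fin n ⊕ Fin n) 𝕜} {k l : ℕ} {c d : S → 𝕜}
    (hc : IsPolynomialIn H k c) (hd : IsPolynomialIn H l d) :
    IsPolynomialIn H (k + l) (c * d) := by
  obtain ⟨P, hP, h⟩ := hc.exists_le (Nat.le_add_right k l)
  obtain ⟨Q, hQ, h'⟩ := hd.exists_le (Nat.le_add_left l k)
  exact ⟨P * Q, (MvPolynomial.totalDegree_mul _ _).trans (add_le_add hP hQ),
    fun t => by simp [h, h']⟩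

/-- The filtration by polynomials in the coefficients of `H`. -/
def polynomiality (H : S → MvPowerSeries (Fin n ⊕ Fin n) 𝕜) : LevelFiltration 𝕜 S where
  toFun _ k :=
    { carrier := {c | (k < 0 → c = 0) ∧ IsPolynomialIn H k.toNat c}
      add_mem' := fun {a b} ha hb => ⟨fun h => by rw [ha.1 h, hb.1 h, add_zero], by
        obtain ⟨P, hP, h⟩ := ha.2
        obtain ⟨Q, hQ, h'⟩ := hb.2
        exact ⟨P + Q, (MvPolynomial.totalDegree_add _ _).trans (max_le hP hQ),
          fun t => by simp [h, h']⟩⟩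
      zero_mem' := ⟨fun _ => rfl, 0, by simp, by simp⟩
      smul_mem' := fun r a ha => ⟨fun h => by rw [ha.1 h, smul_zero], by
        obtain ⟨P, hP, h⟩ := ha.2
        exact ⟨r • P, (MvPolynomial.totalDegree_smul_le _ _).trans hP,
          fun t => by simp [h]⟩⟩ }
  neg' := fun hk hc => hc.1 hk
  anti' := fun hc => hc
  one' := ⟨fun h => absurd h (lt_irrefl _), 1, by simp, by simp⟩
  mul' := fun {i j k l c d} _ hc hd => by
    rcases lt_or_ge k 0 with hk | hk
    · rw [hc.1 hk, zero_mul]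
      exact ⟨fun _ => rfl, 0, by simp, by simp⟩
    rcases lt_or_ge l 0 with hl | hl
    · rw [hd.1 hl, mul_zero]
      exact ⟨fun _ => rfl, 0, by simp, by simp⟩
    refine ⟨fun h => by omega, ?_⟩
    rw [Int.toNat_add hk hl]
    exact hc.2.mul hd.2

theorem mem_polynomiality_iff {H : S → MvPowerSeries (Fin n ⊕ Fin n) 𝕜} {i : ℕ} {k : ℤ}
    {c : S → 𝕜} : c ∈ (polynomiality H).toFun i k ↔ (k < 0 → c = 0) ∧ IsPolynomialIn H k.toNat c :=
  Iff.rfl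

theorem exists_polynomial_of_mem {H : S → MvPowerSeries (Fin n ⊕ Fin n) 𝕜} {i : ℕ}
    {f : S → MvPowerSeries (Fin n ⊕ Fin n) 𝕜} (hf : (polynomiality H).Mem i 2 f) {l : ℕ}
    (hl : 2 ≤ l) {m : (Fin n ⊕ Fin n) →₀ ℕ} (hm : m.degree = l) :
    ∃ P : MvPolynomial (CoeffIndex n l) 𝕜, P.totalDegree ≤ l - 2 ∧
      ∀ t, coeff m (f t) = MvPolynomial.eval (fun j => coeff j.1 (H t)) P := by
  obtain ⟨k, rfl⟩ := Nat.exists_eq_add_of_le' hl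
  have h := (mem_polynomiality_iff.1 (hf m)).2
  have hk : ((m.degree : ℤ) - 2).toNat = k := by omega
  rw [hk] at h
  exact h

/-- A coefficient of `H` of degree `d ≥ 3` is a single variable, of degree `1 ≤ d - 2`. -/
theorem mem_higher {H G : S → MvPowerSeries (Fin n ⊕ Fin n) 𝕜}
    (hG : ∀ t m, m.degree < 3 → coeff m (G t) = 0)
    (hGH : ∀ t m, 3 ≤ m.degree → coeff m (G t) = coeff m (H t)) :
    (polynomiality H).Mem 2 2 G := fun m => by
  rcases lt_or_ge m.degree 3 with hm | hm
  · refine mem_polynomiality_iff.2 ⟨fun _ => funext fun t => hG t m hm, 0, by simp, fun t => ?_⟩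
    simp [hG t m hm]
  · refine mem_polynomiality_iff.2 ⟨fun h => by omega, MvPolynomial.X ⟨m, hm, by omega⟩, ?_, fun t => ?_⟩
    · rw [MvPolynomial.totalDegree_X]
      omega
    · simp [hGH t m hm]

/-- The coefficient at `m` is read off an iterate whose number depends on `m` only and not on `t`,
so induction over iterates suffices. -/
theorem mem_solution {H G : S → MvPowerSeries (Fin n ⊕ Fin n) 𝕜} (lam : Fin n → 𝕜)
    (hG : (polynomiality H).Mem 2 2 G) (o : Option (Fin n ⊕ Fin n)) :
    (polynomiality H).Mem 1 (shift o) (fun t => solution lam (G t) o) := fun m => by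
  have h : ∀ k o, (polynomiality H).Mem 1 (shift o) (fun t => (step lam (G t))^[k] 0 o) := by
    intro k
    induction k with
    | zero => exact fun o => LevelFiltration.Mem.zero
    | succ k ih =>
      simp only [Function.iterate_succ_apply']
      exact fun o => (LevelFiltration.mem_step lam ih hG o).of_succ
  exact h (m.degree + 1) o m

end Polynomiality

/-! ### Generated transformations are canonical; uniqueness of the new hamiltonian. -/

section Canonical

open Matrix

variable {𝕜 : Type*} [RCLike 𝕜] {n : ℕ}

theorem pderiv_comm {σ R : Type*} [CommRing R] (i j : σ) (f : MvPowerSeries σ R) :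
    pderiv R i (pderiv R j f) = pderiv R j (pderiv R i f) := by
  classical
  ext m
  simp only [coeff_pderiv, add_right_comm m (Finsupp.single i 1) (Finsupp.single j 1),
    Finsupp.add_apply]
  by_cases hij : i = j
  · subst hij
    rfl
  · simp [hij, Ne.symm hij]
    ring

theorem constantCoeff_elim {φ ψ : Fin n → MvPowerSeries (Fin n ⊕ Fin n) 𝕜}
    (hφ : ∀ k, constantCoeff (φ k) = 0) (hψ : ∀ k, constantCoeff (ψ k) = 0)
    (j : Fin n ⊕ Fin n) : constantCoeff (Sum.elim φ ψ j) = 0 := by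
  cases j
  · exact hφ _
  · exact hψ _

theorem pderiv_comp {φ ψ : Fin n → MvPowerSeries (Fin n ⊕ Fin n) 𝕜}
    (hφ : ∀ k, constantCoeff (φ k) = 0) (hψ : ∀ k, constantCoeff (ψ k) = 0)
    (f : MvPowerSeries (Fin n ⊕ Fin n) 𝕜) (i : Fin n ⊕ Fin n) :
    pderiv 𝕜 i (comp f φ ψ) = ∑ j, comp (pderiv 𝕜 (Sum.inl j) f) φ ψ * pderiv 𝕜 i (φ j) +
      ∑ j, comp (pderiv 𝕜 (Sum.inr j) f) φ ψ * pderiv 𝕜 i (ψ j) := by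
  rw [comp, pderiv_subst (constantCoeff_elim hφ hψ), Fintype.sum_sum_type]
  rfl

theorem constantCoeff_eq_zero_of_component {σ : Type*} {f : MvPowerSeries σ 𝕜}
    (hf : homogeneousComponent 0 f = 0) : constantCoeff f = 0 := by
  have := congrArg (coeff 0) hf
  simpa [coeff_homogeneousComponent] using this

/-- The matrix of the partial derivatives of the `f k` in the variables `ι l`. -/
def jacobian (f : Fin n → MvPowerSeries (Fin n ⊕ Fin n) 𝕜) (ι : Fin n → Fin n ⊕ Fin n) :
    Matrix (Fin n) (Fin n) (MvPowerSeries (Fin n ⊕ Fin n) 𝕜) :=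
  Matrix.of fun k l => pderiv 𝕜 (ι l) (f k)

/-- Differentiate the generating equations. `A`, `B`, `E` are the blocks `v_{xx}`, `v_{ηx}`,
`v_{ηη}` of the Hessian of `v` at `(φ, η)`; `A` and `E` are symmetric because partial derivatives
commute. -/
theorem IsGeneratedBy.exists_jacobian {v : MvPowerSeries (Fin n ⊕ Fin n) 𝕜}
    {φ ψ : Fin n → MvPowerSeries (Fin n ⊕ Fin n) 𝕜} (h : IsGeneratedBy v φ ψ) :
    ∃ A B E : Matrix (Fin n) (Fin n) (MvPowerSeries (Fin n ⊕ Fin n) 𝕜),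
      Aᵀ = A ∧ Eᵀ = E ∧ B * jacobian φ Sum.inl = 1 ∧ B * jacobian φ Sum.inr = -E ∧
      jacobian ψ Sum.inl = A * jacobian φ Sum.inl ∧
      jacobian ψ Sum.inr = A * jacobian φ Sum.inr + Bᵀ := by
  set c : MvPowerSeries (Fin n ⊕ Fin n) 𝕜 → MvPowerSeries (Fin n ⊕ Fin n) 𝕜 :=
    fun f => comp f φ (fun j => X (Sum.inr j)) with hc
  have chain : ∀ f i, pderiv 𝕜 i (c f) = ∑ j, c (pderiv 𝕜 (Sum.inl j) f) * pderiv 𝕜 i (φ j) +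
      ∑ j, c (pderiv 𝕜 (Sum.inr j) f) * pderiv 𝕜 i (X (Sum.inr j)) :=
    fun f i => pderiv_comp (fun k => constantCoeff_eq_zero_of_component (h.φ_zero k))
      (fun k => constantCoeff_X _) f i
  have chain_inl : ∀ f l, pderiv 𝕜 (Sum.inl l) (c f) =
      ∑ j, c (pderiv 𝕜 (Sum.inl j) f) * pderiv 𝕜 (Sum.inl l) (φ j) := fun f l => by
    rw [chain, add_eq_left]
    exact Finset.sum_eq_zero fun j _ => by rw [pderiv_X_of_ne (by simp), mul_zero]
  have chain_inr : ∀ f l, pderiv 𝕜 (Sum.inr l) (c f) =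
      ∑ j, c (pderiv 𝕜 (Sum.inl j) f) * pderiv 𝕜 (Sum.inr l) (φ j) +
        c (pderiv 𝕜 (Sum.inr l) f) := fun f l => by
    rw [chain]
    congr 1
    rw [Finset.sum_eq_single l (fun j _ hj => by rw [pderiv_X_of_ne (by simpa), mul_zero])
      (by simp), pderiv_X_self, mul_one]
  refine ⟨Matrix.of fun k j => c (pderiv 𝕜 (Sum.inl j) (pderiv 𝕜 (Sum.inl k) v)),
    Matrix.of fun k j => c (pderiv 𝕜 (Sum.inl j) (pderiv 𝕜 (Sum.inr k) v)),
    Matrix.of fun k j => c (pderiv 𝕜 (Sum.inr j) (pderiv 𝕜 (Sum.inr k) v)), ?_, ?_, ?_, ?_, ?_, ?_⟩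
  · ext1 k j
    simp only [transpose_apply, of_apply]
    rw [pderiv_comm]
  · ext1 k j
    simp only [transpose_apply, of_apply]
    rw [pderiv_comm]
  · ext1 k l
    have := congrArg (pderiv 𝕜 (Sum.inl l)) (h.position k)
    rw [chain_inl] at this
    rw [mul_apply]
    simp only [jacobian, of_apply]
    rw [← this, one_apply]
    split_ifs with hkl
    · rw [hkl, pderiv_X_self]
    · rw [pderiv_X_of_ne (by simpa)]
  · ext1 k l
    have := congrArg (pderiv 𝕜 (Sum.inr l)) (h.position k)
    rw [chain_inr, pderiv_X_of_ne (by simp)] at this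
    rw [mul_apply, Matrix.neg_apply]
    exact eq_neg_of_add_eq_zero_left this.symm
  · ext1 k l
    rw [mul_apply]
    simp only [jacobian, of_apply]
    rw [h.momentum k, chain_inl]
  · ext1 k l
    rw [Matrix.add_apply, mul_apply]
    simp only [jacobian, of_apply, transpose_apply]
    rw [h.momentum k, chain_inr, pderiv_comm]

theorem poissonBracket_eq (f g : Fin n → MvPowerSeries (Fin n ⊕ Fin n) 𝕜) (i j : Fin n) :
    poissonBracket (f i) (g j) = (jacobian f Sum.inl * (jacobian g Sum.inr)ᵀ -
      jacobian f Sum.inr * (jacobian g Sum.inl)ᵀ) i j := by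
  simp [poissonBracket, jacobian, mul_apply]

/-- With `P = φ_ξ` and `Q = φ_η`, one has `P = B⁻¹` and `Q = -P E`, so `P Qᵀ` is symmetric; the
brackets involving `ψ` then follow from the symmetry of `A`. -/
theorem IsGeneratedBy.isCanonical {v : MvPowerSeries (Fin n ⊕ Fin n) 𝕜}
    {φ ψ : Fin n → MvPowerSeries (Fin n ⊕ Fin n) 𝕜} (h : IsGeneratedBy v φ ψ) :
    IsCanonical φ ψ := by
  obtain ⟨A, B, E, hA, hE, hBP, hBQ, hS, hT⟩ := h.exists_jacobian
  -- A one-sided inverse of a square matrix over a commutative ring is two-sided.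
  have hPB := mul_eq_one_comm.1 hBP
  have hQ : jacobian φ Sum.inr = -(jacobian φ Sum.inl * E) := by
    rw [← mul_neg, ← hBQ, ← Matrix.mul_assoc, hPB, Matrix.one_mul]
  have hPQ : jacobian φ Sum.inl * (jacobian φ Sum.inr)ᵀ =
      jacobian φ Sum.inr * (jacobian φ Sum.inl)ᵀ := by
    rw [hQ, transpose_neg, transpose_mul, hE, Matrix.neg_mul, Matrix.mul_neg, Matrix.mul_assoc]
  have hφψ : jacobian φ Sum.inl * (jacobian ψ Sum.inr)ᵀ -
      jacobian φ Sum.inr * (jacobian ψ Sum.inl)ᵀ = 1 := by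
    rw [hS, hT, transpose_add, transpose_mul, transpose_mul, hA, transpose_transpose,
      Matrix.mul_add, ← Matrix.mul_assoc, ← Matrix.mul_assoc, hPQ, hPB, add_sub_cancel_left]
  refine ⟨fun i j => ?_, fun i j => ?_, fun i j => ?_⟩
  · rw [poissonBracket_eq, hPQ, sub_self, Matrix.zero_apply]
  · have : jacobian ψ Sum.inl * (jacobian ψ Sum.inr)ᵀ -
        jacobian ψ Sum.inr * (jacobian ψ Sum.inl)ᵀ = 0 := by
      have h1 : Bᵀ * (jacobian ψ Sum.inl)ᵀ = A := by
        rw [hS, ← transpose_mul, Matrix.mul_assoc, hPB, Matrix.mul_one, hA]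
      calc _ = A * (jacobian φ Sum.inl * (jacobian ψ Sum.inr)ᵀ -
            jacobian φ Sum.inr * (jacobian ψ Sum.inl)ᵀ) - Bᵀ * (jacobian ψ Sum.inl)ᵀ := by
            conv_lhs => rw [hT, Matrix.add_mul, ← hT]
            conv_lhs => enter [1]; rw [hS]
            rw [Matrix.mul_sub, Matrix.mul_assoc, Matrix.mul_assoc, sub_sub]
        _ = 0 := by rw [hφψ, h1, Matrix.mul_one, sub_self]
    rw [poissonBracket_eq, this, Matrix.zero_apply]
  · rw [poissonBracket_eq, hφψ, one_apply]

theorem flowDeriv_eq_poissonBracket (K f : MvPowerSeries (Fin n ⊕ Fin n) 𝕜) :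
    flowDeriv K f = poissonBracket f K := by
  simp only [flowDeriv, poissonBracket, mul_neg, sub_eq_add_neg]

theorem poissonBracket_swap (f g : MvPowerSeries (Fin n ⊕ Fin n) 𝕜) :
    poissonBracket f g = -poissonBracket g f := by
  rw [poissonBracket, poissonBracket, ← Finset.sum_neg_distrib]
  exact Finset.sum_congr rfl fun k _ => by ring

theorem poissonBracket_comp {φ ψ : Fin n → MvPowerSeries (Fin n ⊕ Fin n) 𝕜}
    (hφ : ∀ k, constantCoeff (φ k) = 0) (hψ : ∀ k, constantCoeff (ψ k) = 0)
    (f H : MvPowerSeries (Fin n ⊕ Fin n) 𝕜) :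
    poissonBracket f (comp H φ ψ) =
      ∑ j, comp (pderiv 𝕜 (Sum.inl j) H) φ ψ * poissonBracket f (φ j) +
      ∑ j, comp (pderiv 𝕜 (Sum.inr j) H) φ ψ * poissonBracket f (ψ j) := by
  simp only [poissonBracket, pderiv_comp hφ hψ, mul_add, Finset.mul_sum, Finset.sum_sub_distrib,
    Finset.sum_add_distrib, mul_sub]
  rw [Finset.sum_comm (s := Finset.univ) (f := fun i j => pderiv 𝕜 (Sum.inl i) f * _),
    Finset.sum_comm (s := Finset.univ) (f := fun i j => pderiv 𝕜 (Sum.inl i) f *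
      (comp (pderiv 𝕜 (Sum.inr j) H) φ ψ * _)),
    Finset.sum_comm (s := Finset.univ) (f := fun i j => pderiv 𝕜 (Sum.inr i) f *
      (comp (pderiv 𝕜 (Sum.inl j) H) φ ψ * _)),
    Finset.sum_comm (s := Finset.univ) (f := fun i j => pderiv 𝕜 (Sum.inr i) f *
      (comp (pderiv 𝕜 (Sum.inr j) H) φ ψ * _))]
  simp only [mul_left_comm]
  ring

/-- Expand the bracket with `H(φ, ψ)` by the chain rule; the canonical relations leave one term. -/
theorem IsGeneratedBy.transformsSystem {v : MvPowerSeries (Fin n ⊕ Fin n) 𝕜}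
    {φ ψ : Fin n → MvPowerSeries (Fin n ⊕ Fin n) 𝕜} (h : IsGeneratedBy v φ ψ)
    (H : MvPowerSeries (Fin n ⊕ Fin n) 𝕜) : TransformsSystem H φ ψ (comp H φ ψ) := by
  have hφ := fun k => constantCoeff_eq_zero_of_component (h.φ_zero k)
  have hψ := fun k => constantCoeff_eq_zero_of_component (h.ψ_zero k)
  have hcan := h.isCanonical
  refine ⟨fun k => ?_, fun k => ?_⟩
  · simp [flowDeriv_eq_poissonBracket, poissonBracket_comp hφ hψ, hcan.φφ, hcan.φψ]
  · simp [flowDeriv_eq_poissonBracket, poissonBracket_comp hφ hψ, hcan.ψψ, hcan.φψ,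
      poissonBracket_swap (ψ k) (φ _)]

theorem flowDeriv_sub (K K' f : MvPowerSeries (Fin n ⊕ Fin n) 𝕜) :
    flowDeriv (K - K') f = flowDeriv K f - flowDeriv K' f := by
  simp only [flowDeriv, map_sub, ← Finset.sum_sub_distrib]
  exact Finset.sum_congr rfl fun k _ => by ring

theorem flowDeriv_eq_mulVec (K : MvPowerSeries (Fin n ⊕ Fin n) 𝕜)
    (f : Fin n → MvPowerSeries (Fin n ⊕ Fin n) 𝕜) (k : Fin n) :
    flowDeriv K (f k) = (jacobian f Sum.inl *ᵥ (fun j => pderiv 𝕜 (Sum.inr j) K) -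
      jacobian f Sum.inr *ᵥ (fun j => pderiv 𝕜 (Sum.inl j) K)) k := by
  simp [flowDeriv, jacobian, mulVec, dotProduct, Finset.sum_add_distrib, sub_eq_add_neg]

/-- The gradient of `K - K'` solves a homogeneous linear system. Eliminating with `A` leaves `Bᵀ p =
0`, and `B` is invertible, so `p` and then `q` vanish. -/
theorem IsGeneratedBy.eq_of_transformsSystem {v : MvPowerSeries (Fin n ⊕ Fin n) 𝕜}
    {φ ψ : Fin n → MvPowerSeries (Fin n ⊕ Fin n) 𝕜} (h : IsGeneratedBy v φ ψ)
    {H K K' : MvPowerSeries (Fin n ⊕ Fin n) 𝕜} (hK : TransformsSystem H φ ψ K)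
    (hK' : TransformsSystem H φ ψ K') (h0 : constantCoeff K = constantCoeff K') : K = K' := by
  obtain ⟨A, B, E, -, -, hBP, -, hS, hT⟩ := h.exists_jacobian
  set p : Fin n → MvPowerSeries (Fin n ⊕ Fin n) 𝕜 := fun j => pderiv 𝕜 (Sum.inl j) (K - K') with hp
  set q : Fin n → MvPowerSeries (Fin n ⊕ Fin n) 𝕜 := fun j => pderiv 𝕜 (Sum.inr j) (K - K') with hq
  have h1 : jacobian φ Sum.inl *ᵥ q - jacobian φ Sum.inr *ᵥ p = 0 := funext fun k => by
    rw [← flowDeriv_eq_mulVec, flowDeriv_sub, hK.position, hK'.position, sub_self, Pi.zero_apply]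
  have h2 : jacobian ψ Sum.inl *ᵥ q - jacobian ψ Sum.inr *ᵥ p = 0 := funext fun k => by
    rw [← flowDeriv_eq_mulVec, flowDeriv_sub, hK.momentum, hK'.momentum, sub_self, Pi.zero_apply]
  have h3 : Bᵀ *ᵥ p = 0 := by
    rw [hS, hT, add_mulVec, ← mulVec_mulVec, ← mulVec_mulVec, ← sub_sub, ← mulVec_sub, h1,
      mulVec_zero, zero_sub, neg_eq_zero] at h2
    exact h2
  have hp0 : p = 0 := by
    have : (jacobian φ Sum.inl)ᵀ * Bᵀ = 1 := by rw [← transpose_mul, hBP, transpose_one]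
    rw [← one_mulVec p, ← this, ← mulVec_mulVec, h3, mulVec_zero]
  have hq0 : q = 0 := by
    rw [hp0, mulVec_zero, sub_zero] at h1
    rw [← one_mulVec q, ← hBP, ← mulVec_mulVec, h1, mulVec_zero]
  refine pderiv.ext (fun i => ?_) h0
  rw [← sub_eq_zero, ← map_sub]
  cases i with
  | inl j => exact congrFun hp0 j
  | inr j => exact congrFun hq0 j

end Canonical

/-! ### Coefficientwise form of the conditions on degrees and on products `ω_k`. -/

section Products

variable {𝕜 : Type*} [RCLike 𝕜] {n : ℕ}

/-- The exponents of `∏_k ω_k ^ d_k`. -/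
def doubled (d : Fin n →₀ ℕ) : (Fin n ⊕ Fin n) →₀ ℕ :=
  Finsupp.equivFunOnFinite.symm (Sum.elim d d)

@[simp]
theorem doubled_inl (d : Fin n →₀ ℕ) (k : Fin n) : doubled d (Sum.inl k) = d k := rfl

@[simp]
theorem doubled_inr (d : Fin n →₀ ℕ) (k : Fin n) : doubled d (Sum.inr k) = d k := rfl

theorem doubled_add (d e : Fin n →₀ ℕ) : doubled (d + e) = doubled d + doubled e := by
  ext j
  cases j <;> simp

theorem X_mul_X_eq_monomial (k : Fin n) :
    (X (Sum.inl k) * X (Sum.inr k) : MvPowerSeries (Fin n ⊕ Fin n) 𝕜) =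
      monomial (doubled (Finsupp.single k 1)) 1 := by
  classical
  have : doubled (Finsupp.single k 1) =
      Finsupp.single (Sum.inl k) 1 + Finsupp.single (Sum.inr k) 1 := by
    ext j
    cases j <;> simp [Finsupp.single_apply]
  rw [X, X, monomial_mul_monomial, one_mul, this]

theorem prod_X_mul_X (d : Fin n →₀ ℕ) :
    (d.prod fun k e => (X (Sum.inl k) * X (Sum.inr k) : MvPowerSeries (Fin n ⊕ Fin n) 𝕜) ^ e) =
      monomial (doubled d) 1 := by
  classical
  induction d using Finsupp.induction_linear with
  | zero =>
    have : doubled (0 : Fin n →₀ ℕ) = 0 := by ext j; cases j <;> rfl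
    rw [this]
    simp
  | add d e hd he =>
    rw [Finsupp.prod_add_index' (by simp) (by simp [pow_add]), hd, he, monomial_mul_monomial,
      doubled_add, one_mul]
  | single k e =>
    have : doubled (Finsupp.single k e) = e • doubled (Finsupp.single k 1) := by
      ext j
      cases j <;> simp [Finsupp.single_apply]
    rw [Finsupp.prod_single_index (by simp), X_mul_X_eq_monomial, monomial_pow, one_pow, this]

theorem isResonant_doubled (d : Fin n →₀ ℕ) : IsResonant (doubled d) := fun _ => rfl

theorem IsResonant.eq_doubled {m : (Fin n ⊕ Fin n) →₀ ℕ} (hm : IsResonant m) :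
    ∃ d : Fin n →₀ ℕ, m = doubled d := by
  refine ⟨Finsupp.equivFunOnFinite.symm fun k => m (Sum.inl k), ?_⟩
  ext j
  cases j with
  | inl k => rfl
  | inr k => exact (hm k).symm

theorem doubled_injective : Function.Injective (doubled (n := n)) := fun d e h => by
  ext k
  exact DFunLike.congr_fun h (Sum.inl k)

theorem coeff_subst_products (f : MvPowerSeries (Fin n) 𝕜) (m : (Fin n ⊕ Fin n) →₀ ℕ) :
    coeff m (subst (fun k => (X (Sum.inl k) * X (Sum.inr k) : MvPowerSeries (Fin n ⊕ Fin n) 𝕜)) f) =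
      ∑ᶠ d, coeff d f * coeff m (monomial (doubled d) (1 : 𝕜)) := by
  rw [coeff_subst (hasSubst_of_constantCoeff_zero fun k => by simp)]
  simp_rw [prod_X_mul_X, smul_eq_mul]

/-- Substitution maps the monomial `d` to the monomial `doubled d`, injectively and onto the
resonant ones. -/
theorem isSeriesInProducts_iff (K : MvPowerSeries (Fin n ⊕ Fin n) 𝕜) :
    IsSeriesInProducts K ↔ ∀ m, ¬ IsResonant m → coeff m K = 0 := by
  classical
  constructor
  · rintro ⟨f, rfl⟩ m hm
    rw [coeff_subst_products]
    refine finsum_eq_zero_of_forall_eq_zero fun d => ?_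
    rw [coeff_monomial, if_neg, mul_zero]
    rintro rfl
    exact hm (isResonant_doubled d)
  · intro h
    obtain ⟨f, hf⟩ : ∃ f : MvPowerSeries (Fin n) 𝕜, ∀ d, coeff d f = coeff (doubled d) K :=
      ⟨fun d => coeff (doubled d) K, fun _ => rfl⟩
    refine ⟨f, ?_⟩
    ext m
    rw [coeff_subst_products]
    by_cases hm : IsResonant m
    · obtain ⟨d, rfl⟩ := hm.eq_doubled
      rw [finsum_eq_single _ d fun e he => by
        rw [coeff_monomial, if_neg fun h => he (doubled_injective h).symm, mul_zero]]
      rw [coeff_monomial_same, mul_one, hf]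
    · rw [h m hm, finsum_eq_zero_of_forall_eq_zero fun d => ?_]
      rw [coeff_monomial, if_neg, mul_zero]
      rintro rfl
      exact hm (isResonant_doubled d)

/-- The quadratic form `∑_k lam_k x_k y_k`. -/
def quadratic (lam : Fin n → 𝕜) : MvPowerSeries (Fin n ⊕ Fin n) 𝕜 :=
  ∑ k, C (lam k) * X (Sum.inl k) * X (Sum.inr k)

theorem coeff_quadratic_of_degree_ne (lam : Fin n → 𝕜) {m : (Fin n ⊕ Fin n) →₀ ℕ}
    (hm : m.degree ≠ 2) : coeff m (quadratic lam) = 0 := by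
  classical
  rw [quadratic, map_sum]
  refine Finset.sum_eq_zero fun k _ => ?_
  rw [mul_assoc, coeff_C_mul, X, X, monomial_mul_monomial, coeff_monomial, if_neg, mul_zero]
  rintro rfl
  exact hm (by simp)

theorem coeff_quadratic_of_not_isResonant (lam : Fin n → 𝕜) {m : (Fin n ⊕ Fin n) →₀ ℕ}
    (hm : ¬ IsResonant m) : coeff m (quadratic lam) = 0 := by
  classical
  rw [quadratic, map_sum]
  refine Finset.sum_eq_zero fun k _ => ?_
  rw [mul_assoc, coeff_C_mul, X_mul_X_eq_monomial, coeff_monomial, if_neg, mul_zero]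
  rintro rfl
  exact hm (isResonant_doubled _)

/-- Serves both `H`, with `lam`, and `v`, with `lam = 1`. -/
theorem components_iff (lam : Fin n → 𝕜) (f : MvPowerSeries (Fin n ⊕ Fin n) 𝕜) :
    (homogeneousComponent 0 f = 0 ∧ homogeneousComponent 1 f = 0 ∧
      homogeneousComponent 2 f = quadratic lam) ↔
      ∀ m, m.degree < 3 → coeff m (f - quadratic lam) = 0 := by
  constructor
  · rintro ⟨h0, h1, h2⟩ m hm
    rw [map_sub]
    have e0 := congrArg (coeff m) h0
    have e1 := congrArg (coeff m) h1
    have e2 := congrArg (coeff m) h2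
    rw [coeff_homogeneousComponent] at e0 e1 e2
    by_cases hm2 : m.degree = 2
    · rw [← e2, if_pos hm2, sub_self]
    · rw [coeff_quadratic_of_degree_ne _ hm2, sub_zero]
      by_cases hm1 : m.degree = 1
      · rwa [if_pos hm1] at e1
      · rwa [if_pos (by omega)] at e0
  · intro h
    have key : ∀ p < 3, ∀ m : (Fin n ⊕ Fin n) →₀ ℕ, coeff m (homogeneousComponent p f) =
        if m.degree = p then coeff m (quadratic lam) else 0 := fun p hp m => by
      rw [coeff_homogeneousComponent]
      split_ifs with hm
      · have := h m (by omega)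
        rwa [map_sub, sub_eq_zero] at this
      · rfl
    refine ⟨?_, ?_, ?_⟩ <;> ext m <;> rw [key _ (by omega)] <;> split_ifs with hm
    · rw [coeff_quadratic_of_degree_ne _ (by omega), map_zero]
    · rw [map_zero]
    · rw [coeff_quadratic_of_degree_ne _ (by omega), map_zero]
    · rw [map_zero]
    · rfl
    · rw [coeff_quadratic_of_degree_ne _ hm]

theorem hasDiagonalQuadraticPart_iff (lam : Fin n → 𝕜) (H : MvPowerSeries (Fin n ⊕ Fin n) 𝕜) :
    HasDiagonalQuadraticPart lam H ↔ ∀ m, m.degree < 3 → coeff m (H - quadratic lam) = 0 := by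
  rw [← components_iff]
  exact ⟨fun h => ⟨h.1, h.2, h.3⟩, fun h => ⟨h.1, h.2.1, h.2.2⟩⟩

theorem isGeneratingSeries_iff (v : MvPowerSeries (Fin n ⊕ Fin n) 𝕜) :
    IsGeneratingSeries v ↔ ∀ m, m.degree < 3 → coeff m (v - quadratic 1) = 0 := by
  have : quadratic (1 : Fin n → 𝕜) = ∑ k, X (Sum.inl k) * X (Sum.inr k) := by simp [quadratic]
  rw [← components_iff, this]
  exact ⟨fun h => ⟨h.1, h.2, h.3⟩, fun h => ⟨h.1, h.2.1, h.2.2⟩⟩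

theorem tangent_iff (f : MvPowerSeries (Fin n ⊕ Fin n) 𝕜) (j : Fin n ⊕ Fin n) :
    (homogeneousComponent 0 f = 0 ∧ homogeneousComponent 1 f = X j) ↔
      ∀ m, m.degree < 2 → coeff m (f - X j) = 0 := by
  classical
  have hX : ∀ m : (Fin n ⊕ Fin n) →₀ ℕ, m.degree ≠ 1 → coeff m (X j : MvPowerSeries _ 𝕜) = 0 := by
    intro m hm
    rw [coeff_X, if_neg]
    rintro rfl
    exact hm (by simp)
  constructor
  · rintro ⟨h0, h1⟩ m hm
    rw [map_sub]
    have e0 := congrArg (coeff m) h0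
    have e1 := congrArg (coeff m) h1
    rw [coeff_homogeneousComponent] at e0 e1
    by_cases hm1 : m.degree = 1
    · rw [← e1, if_pos hm1, sub_self]
    · rw [hX _ hm1, sub_zero]
      rwa [if_pos (by omega)] at e0
  · intro h
    have key : ∀ p < 2, ∀ m : (Fin n ⊕ Fin n) →₀ ℕ, coeff m (homogeneousComponent p f) =
        if m.degree = p then coeff m (X j : MvPowerSeries _ 𝕜) else 0 := fun p hp m => by
      rw [coeff_homogeneousComponent]
      split_ifs with hm
      · have := h m (by omega)
        rwa [map_sub, sub_eq_zero] at this
      · rfl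
    refine ⟨?_, ?_⟩ <;> ext m <;> rw [key _ (by omega)] <;> split_ifs with hm
    · rw [hX _ (by omega), map_zero]
    · rw [map_zero]
    · rfl
    · rw [hX _ hm]

/-- The operators `X_i ∂_i` are diagonal on monomials; both `divisor` and the factor `m.degree`
arise from them. -/
theorem coeff_X_mul_pderiv {σ R : Type*} [CommRing R] (i : σ) (f : MvPowerSeries σ R)
    (m : σ →₀ ℕ) : coeff m (X i * pderiv R i f) = m i * coeff m f := by
  classical
  by_cases hm : m i = 0
  · rw [hm, Nat.cast_zero, zero_mul, X, coeff_monomial_mul, if_neg]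
    intro h
    have := h i
    simp [hm] at this
  · obtain ⟨e, rfl⟩ : ∃ e, m = Finsupp.single i 1 + e :=
      exists_add_of_le (by simpa using Nat.one_le_iff_ne_zero.2 hm)
    rw [X, coeff_add_monomial_mul, one_mul, coeff_pderiv, add_comm e]
    simp
    ring

end Products

/-! ### Normalizing transformations as fixed points. -/

section Normalization

variable {𝕜 : Type*} [RCLike 𝕜] {n : ℕ}
  {U : Option (Fin n ⊕ Fin n) → MvPowerSeries (Fin n ⊕ Fin n) 𝕜}

/-- The generating series encoded in `U`. -/
def generatingSeries (U : Option (Fin n ⊕ Fin n) → MvPowerSeries (Fin n ⊕ Fin n) 𝕜) :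
    MvPowerSeries (Fin n ⊕ Fin n) 𝕜 := quadratic 1 + U none

/-- The position part of the transformation encoded in `U`. -/
def positions (U : Option (Fin n ⊕ Fin n) → MvPowerSeries (Fin n ⊕ Fin n) 𝕜) (k : Fin n) :
    MvPowerSeries (Fin n ⊕ Fin n) 𝕜 := fullArg U (Sum.inl k)

/-- The momentum part of the transformation encoded in `U`. -/
def momenta (U : Option (Fin n ⊕ Fin n) → MvPowerSeries (Fin n ⊕ Fin n) 𝕜) (k : Fin n) :
    MvPowerSeries (Fin n ⊕ Fin n) 𝕜 := fullArg U (Sum.inr k)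

theorem exists_encoding (v : MvPowerSeries (Fin n ⊕ Fin n) 𝕜)
    (φ ψ : Fin n → MvPowerSeries (Fin n ⊕ Fin n) 𝕜) :
    ∃ U, v = generatingSeries U ∧ φ = positions U ∧ ψ = momenta U := by
  refine ⟨fun o => o.elim (v - quadratic 1) (Sum.elim (fun k => φ k - X (Sum.inl k))
    (fun k => ψ k - X (Sum.inr k))), ?_, ?_, ?_⟩
  · simp [generatingSeries]
  · funext k
    simp [positions, fullArg]
  · funext k
    simp [momenta, fullArg]

theorem comp_positions_momenta (f : MvPowerSeries (Fin n ⊕ Fin n) 𝕜) :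
    comp f (positions U) (momenta U) = subst (fullArg U) f := by
  rw [comp]
  congr 1
  funext j
  cases j <;> rfl

theorem comp_positions (f : MvPowerSeries (Fin n ⊕ Fin n) 𝕜) :
    comp f (positions U) (fun j => X (Sum.inr j)) = subst (mixedArg U) f := rfl

theorem vanishes_iff : Vanishes U ↔ IsGeneratingSeries (generatingSeries U) ∧
    (∀ k, homogeneousComponent 0 (positions U k) = 0 ∧
      homogeneousComponent 1 (positions U k) = X (Sum.inl k)) ∧
    ∀ k, homogeneousComponent 0 (momenta U k) = 0 ∧
      homogeneousComponent 1 (momenta U k) = X (Sum.inr k) := by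
  simp only [isGeneratingSeries_iff, tangent_iff, generatingSeries, positions, momenta, fullArg,
    add_sub_cancel_left]
  constructor
  · intro h
    exact ⟨fun m hm => h none m (by simp only [shift]; omega),
      fun k m hm => h (some (Sum.inl k)) m (by simp only [shift]; omega),
      fun k m hm => h (some (Sum.inr k)) m (by simp only [shift]; omega)⟩
  · rintro ⟨h0, h1, h2⟩ o m hm
    match o with
    | none => exact h0 m (by simp only [shift] at hm; omega)
    | some (Sum.inl k) => exact h1 k m (by simp only [shift] at hm; omega)
    | some (Sum.inr k) => exact h2 k m (by simp only [shift] at hm; omega)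

theorem Vanishes.constantCoeff (hU : Vanishes U) (j : Fin n ⊕ Fin n) :
    constantCoeff (U (some j)) = 0 := by
  rw [← coeff_zero_eq_constantCoeff_apply]
  exact hU _ _ (by simp [shift])

theorem Vanishes.hasSubst_fullArg (hU : Vanishes U) : HasSubst (fullArg U) :=
  hasSubst_of_constantCoeff_zero fun j => by simp [fullArg, hU.constantCoeff]

theorem Vanishes.hasSubst_mixedArg (hU : Vanishes U) : HasSubst (mixedArg U) :=
  hasSubst_of_constantCoeff_zero fun j => by
    cases j <;> simp [mixedArg, hU.constantCoeff]

theorem pderiv_inl_quadratic_one (k : Fin n) :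
    pderiv 𝕜 (Sum.inl k) (quadratic (1 : Fin n → 𝕜)) = X (Sum.inr k) := by
  simp only [quadratic, Pi.one_apply, map_one, one_mul, map_sum, Derivation.leibniz]
  rw [Finset.sum_eq_single k]
  · simp [pderiv_X_of_ne]
  · intro j _ hj
    simp [pderiv_X_of_ne, hj]
  · simp

theorem pderiv_inr_quadratic_one (k : Fin n) :
    pderiv 𝕜 (Sum.inr k) (quadratic (1 : Fin n → 𝕜)) = X (Sum.inl k) := by
  simp only [quadratic, Pi.one_apply, map_one, one_mul, map_sum, Derivation.leibniz]
  rw [Finset.sum_eq_single k]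
  · simp [pderiv_X_of_ne]
  · intro j _ hj
    simp [pderiv_X_of_ne, hj]
  · simp

/-- The implicit equations between the transformation and its generating series. -/
def SolvesImplicit (U : Option (Fin n ⊕ Fin n) → MvPowerSeries (Fin n ⊕ Fin n) 𝕜) : Prop :=
  ∀ k, U (some (Sum.inl k)) = -(pderiv 𝕜 (Sum.inr k) (U none) + gradRemainder U (Sum.inr k)) ∧
    U (some (Sum.inr k)) = pderiv 𝕜 (Sum.inl k) (U none) + gradRemainder U (Sum.inl k)

theorem Vanishes.isGeneratedBy_iff (hU : Vanishes U) :
    IsGeneratedBy (generatingSeries U) (positions U) (momenta U) ↔ SolvesImplicit U := by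
  have hs := hU.hasSubst_mixedArg
  obtain ⟨-, h1, h2⟩ := vanishes_iff.1 hU
  have e1 : ∀ k, comp (pderiv 𝕜 (Sum.inr k) (generatingSeries U)) (positions U)
      (fun j => X (Sum.inr j)) = X (Sum.inl k) + U (some (Sum.inl k)) +
        (pderiv 𝕜 (Sum.inr k) (U none) + gradRemainder U (Sum.inr k)) := fun k => by
    rw [comp_positions, generatingSeries, map_add, subst_add hs, pderiv_inr_quadratic_one,
      subst_X hs, gradRemainder, add_sub_cancel]
    rfl
  have e2 : ∀ k, comp (pderiv 𝕜 (Sum.inl k) (generatingSeries U)) (positions U)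
      (fun j => X (Sum.inr j)) = X (Sum.inr k) +
        (pderiv 𝕜 (Sum.inl k) (U none) + gradRemainder U (Sum.inl k)) := fun k => by
    rw [comp_positions, generatingSeries, map_add, subst_add hs, pderiv_inl_quadratic_one,
      subst_X hs, gradRemainder, add_sub_cancel]
    rfl
  constructor
  · intro h k
    have p1 := h.position k
    have p2 := h.momentum k
    rw [e1, add_assoc, left_eq_add] at p1
    rw [e2, momenta, fullArg, add_right_inj] at p2
    exact ⟨eq_neg_of_add_eq_zero_left p1, p2⟩
  · intro h
    refine ⟨fun k => (h1 k).1, fun k => (h1 k).2, fun k => (h2 k).1, fun k => (h2 k).2,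
      fun k => ?_, fun k => ?_⟩
    · rw [e1, add_assoc, left_eq_add, (h k).1, neg_add_cancel]
    · rw [e2, momenta, fullArg, (h k).2]

theorem Vanishes.coeff_comp (hU : Vanishes U) (hU' : SolvesImplicit U) (lam : Fin n → 𝕜)
    (H : MvPowerSeries (Fin n ⊕ Fin n) 𝕜) {m : (Fin n ⊕ Fin n) →₀ ℕ} (hm : ¬ IsResonant m) :
    coeff m (comp H (positions U) (momenta U)) = divisor lam m * coeff m (U none) +
      coeff m (energyRemainder lam (H - quadratic lam) U) := by
  have hs := hU.hasSubst_fullArg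
  have key : comp H (positions U) (momenta U) = quadratic lam +
      ∑ k, C (lam k) * (X (Sum.inl k) * pderiv 𝕜 (Sum.inl k) (U none) -
        X (Sum.inr k) * pderiv 𝕜 (Sum.inr k) (U none)) +
      energyRemainder lam (H - quadratic lam) U := by
    have hH : comp H (positions U) (momenta U) =
        subst (fullArg U) (quadratic lam) + subst (fullArg U) (H - quadratic lam) := by
      rw [comp_positions_momenta, ← subst_add hs, add_sub_cancel]
    rw [hH, energyRemainder, ← add_assoc, add_left_inj, quadratic, subst_sum hs,
      ← Finset.sum_add_distrib, ← Finset.sum_add_distrib]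
    refine Finset.sum_congr rfl fun k _ => ?_
    rw [subst_mul hs, subst_mul hs, subst_X hs, subst_X hs, subst_C', fullArg, fullArg]
    have h1 := (hU' k).1
    have h2 := (hU' k).2
    -- In `(ξ_k + a)(η_k + b) = ξ_k η_k + ξ_k b + η_k a + a b` only the linear occurrences of `a`
    -- and `b` are replaced; `a b` is part of `energyRemainder`.
    linear_combination C (lam k) * X (Sum.inr k) * h1 + C (lam k) * X (Sum.inl k) * h2
  rw [key, map_add, map_add, coeff_quadratic_of_not_isResonant _ hm, zero_add, map_sum, divisor,
    Finset.sum_mul]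
  congr 1
  refine Finset.sum_congr rfl fun k _ => ?_
  rw [coeff_C_mul, map_sub, coeff_X_mul_pderiv, coeff_X_mul_pderiv]
  ring

theorem coeff_normalizationSeries (hU' : SolvesImplicit U) (m : (Fin n ⊕ Fin n) →₀ ℕ) :
    coeff m (normalizationSeries (positions U) (momenta U)) =
      m.degree * coeff m (U none) + coeff m (normRemainder U) := by
  have key : normalizationSeries (positions U) (momenta U) =
      ∑ k, (X (Sum.inl k) * pderiv 𝕜 (Sum.inl k) (U none) +
        X (Sum.inr k) * pderiv 𝕜 (Sum.inr k) (U none)) + normRemainder U := by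
    rw [normalizationSeries, normRemainder, ← Finset.sum_add_distrib]
    refine Finset.sum_congr rfl fun k _ => ?_
    rw [positions, momenta, fullArg, fullArg]
    linear_combination X (Sum.inl k) * (hU' k).2 - X (Sum.inr k) * (hU' k).1
  rw [key, map_add, map_sum, Finsupp.degree_eq_sum, Fintype.sum_sum_type]
  push_cast
  rw [← Finset.sum_add_distrib, Finset.sum_mul]
  congr 1
  refine Finset.sum_congr rfl fun k _ => ?_
  rw [map_add, coeff_X_mul_pderiv, coeff_X_mul_pderiv]
  ring

theorem NonResonant.divisor_ne_zero {lam : Fin n → 𝕜} (hlam : NonResonant lam)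
    {m : (Fin n ⊕ Fin n) →₀ ℕ} (hm : ¬ IsResonant m) : divisor lam m ≠ 0 := fun h => by
  refine hm fun k => ?_
  have := congrFun (hlam (fun k => (m (Sum.inl k) : ℤ) - m (Sum.inr k))
    (by simpa [divisor] using h)) k
  simp only [Pi.zero_apply] at this
  omega

/-- Once the generating equations hold, the fixed-point equation for `w` splits by monomials:
division by `divisor lam m` or by `m.degree` turns it into the vanishing of one coefficient of `H(φ,
ψ)` or of `Φ`. -/
theorem NonResonant.step_eq_iff {lam : Fin n → 𝕜} (hlam : NonResonant lam) (hU : Vanishes U)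
    (H : MvPowerSeries (Fin n ⊕ Fin n) 𝕜) :
    step lam (H - quadratic lam) U = U ↔
      IsGeneratedBy (generatingSeries U) (positions U) (momenta U) ∧
      IsSeriesInProducts (comp H (positions U) (momenta U)) ∧
      HasNoProducts (normalizationSeries (positions U) (momenta U)) := by
  rw [hU.isGeneratedBy_iff, isSeriesInProducts_iff]
  have split : step lam (H - quadratic lam) U = U ↔
      newSeries lam (H - quadratic lam) U = U none ∧ SolvesImplicit U := by
    constructor
    · intro h
      have h0 : newSeries lam (H - quadratic lam) U = U none := congrFun h none
      refine ⟨h0, fun k => ⟨?_, ?_⟩⟩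
      · rw [← h0]
        exact (congrFun h (some (Sum.inl k))).symm
      · rw [← h0]
        exact (congrFun h (some (Sum.inr k))).symm
    · rintro ⟨h0, h⟩
      funext o
      match o with
      | none => exact h0
      | some (Sum.inl k) => rw [step, h0, (h k).1]
      | some (Sum.inr k) => rw [step, h0, (h k).2]
  rw [split, and_comm]
  refine and_congr_right fun hU' => ?_
  have hw : newSeries lam (H - quadratic lam) U = U none ↔ ∀ m,
      coeff m (newSeries lam (H - quadratic lam) U) = coeff m (U none) := MvPowerSeries.ext_iff
  have hres : ∀ m, IsResonant m →
      (coeff m (newSeries lam (H - quadratic lam) U) = coeff m (U none) ↔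
        coeff m (normalizationSeries (positions U) (momenta U)) = 0) := fun m hm => by
    rw [coeff_newSeries, if_pos hm, coeff_normalizationSeries hU']
    -- In degree 0 the definition of `newSeries` uses `0⁻¹ = 0`. Both sides hold there, since `w`
    -- and `normRemainder` have no constant term.
    by_cases h0 : m = 0
    · subst h0
      have : coeff 0 (normRemainder U) = 0 := by simp [normRemainder]
      rw [this, hU none 0 (by simp [shift])]
      simp
    · have hd : (m.degree : 𝕜) ≠ 0 := by simpa [Finsupp.degree_eq_zero_iff] using h0
      rw [neg_mul, neg_eq_iff_eq_neg, inv_mul_eq_iff_eq_mul₀ hd, mul_neg,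
        eq_neg_iff_add_eq_zero, add_comm]
  have hnon : ∀ m, ¬ IsResonant m →
      (coeff m (newSeries lam (H - quadratic lam) U) = coeff m (U none) ↔
        coeff m (comp H (positions U) (momenta U)) = 0) := fun m hm => by
    rw [coeff_newSeries, if_neg hm, hU.coeff_comp hU' lam H hm, neg_mul, neg_eq_iff_eq_neg,
      inv_mul_eq_iff_eq_mul₀ (hlam.divisor_ne_zero hm), mul_neg, eq_neg_iff_add_eq_zero, add_comm]
  rw [hw]
  constructor
  · intro h
    exact ⟨fun m hm => (hnon m hm).1 (h m), fun m hm => (hres m hm).1 (h m)⟩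
  · rintro ⟨h1, h2⟩ m
    by_cases hm : IsResonant m
    · exact (hres m hm).2 (h2 m hm)
    · exact (hnon m hm).2 (h1 m hm)

theorem IsGeneratedBy.constantCoeff_comp {v : MvPowerSeries (Fin n ⊕ Fin n) 𝕜}
    {φ ψ : Fin n → MvPowerSeries (Fin n ⊕ Fin n) 𝕜} (h : IsGeneratedBy v φ ψ)
    {H : MvPowerSeries (Fin n ⊕ Fin n) 𝕜} (hH : MvPowerSeries.constantCoeff H = 0) :
    MvPowerSeries.constantCoeff (comp H φ ψ) = 0 := by
  have h0 := constantCoeff_elim (fun k => constantCoeff_eq_zero_of_component (h.φ_zero k))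
    (fun k => constantCoeff_eq_zero_of_component (h.ψ_zero k))
  exact constantCoeff_subst_eq_zero (hasSubst_of_constantCoeff_zero h0) h0 hH

/-- The normalization of `H` that `solution` provides. -/
theorem NonResonant.isBirkhoffNormalization {lam : Fin n → 𝕜} (hlam : NonResonant lam)
    {H : MvPowerSeries (Fin n ⊕ Fin n) 𝕜} (hH : HasDiagonalQuadraticPart lam H)
    (hU : U = solution lam (H - quadratic lam)) :
    IsBirkhoffNormalization H (generatingSeries U) (positions U) (momenta U)
      (comp H (positions U) (momenta U)) := by
  have hG := (hasDiagonalQuadraticPart_iff lam H).1 hH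
  have hv : Vanishes U := hU ▸ vanishes_solution lam hG
  obtain ⟨h1, h2, h3⟩ := (hlam.step_eq_iff hv H).1 (hU ▸ step_solution lam hG)
  exact ⟨(vanishes_iff.1 hv).1, h1, h1.transformsSystem H,
    h1.constantCoeff_comp (constantCoeff_eq_zero_of_component hH.deg_zero), h2, h3⟩

/-- The transformed system and the zero constant term force `K = H(φ, ψ)`; only then does the
condition that `K` is a series in products make the encoded data a fixed point. -/
theorem NonResonant.eq_solution {lam : Fin n → 𝕜} (hlam : NonResonant lam)
    {H : MvPowerSeries (Fin n ⊕ Fin n) 𝕜} (hH : HasDiagonalQuadraticPart lam H)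
    {v : MvPowerSeries (Fin n ⊕ Fin n) 𝕜} {φ ψ : Fin n → MvPowerSeries (Fin n ⊕ Fin n) 𝕜}
    {K : MvPowerSeries (Fin n ⊕ Fin n) 𝕜} (h : IsBirkhoffNormalization H v φ ψ K)
    (hU : U = solution lam (H - quadratic lam)) :
    v = generatingSeries U ∧ φ = positions U ∧ ψ = momenta U ∧
      K = comp H (positions U) (momenta U) := by
  have hG := (hasDiagonalQuadraticPart_iff lam H).1 hH
  have hg := h.generated
  have hK : K = comp H φ ψ := hg.eq_of_transformsSystem h.transforms (hg.transformsSystem H) (by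
    rw [h.constantCoeff_zero,
      hg.constantCoeff_comp (constantCoeff_eq_zero_of_component hH.deg_zero)])
  obtain ⟨V, rfl, rfl, rfl⟩ := exists_encoding v φ ψ
  have hV : Vanishes V := vanishes_iff.2 ⟨h.generating, fun k => ⟨hg.φ_zero k, hg.φ_one k⟩,
    fun k => ⟨hg.ψ_zero k, hg.ψ_one k⟩⟩
  have : V = U := hU ▸ eq_of_step_eq lam hG hV (vanishes_solution lam hG)
    ((hlam.step_eq_iff hV H).2 ⟨hg, hK ▸ h.inProducts, h.normalized⟩) (step_solution lam hG)
  subst this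
  exact ⟨rfl, rfl, rfl, hK⟩

theorem mem_quadratic {S : Type*} (F : LevelFiltration 𝕜 S) (lam : Fin n → 𝕜) :
    F.Mem 0 2 (fun _ => quadratic lam) := by
  refine LevelFiltration.Mem.sum _ fun k _ => ?_
  simp_rw [mul_assoc]
  exact ((LevelFiltration.Mem.X _).mul (LevelFiltration.Mem.X _) (by omega)).C_mul _

end Normalization

end BirkhoffNF

end

/-! ### The proposition: unique normalization and polynomial dependence. -/

open BirkhoffNF in
theorem proposition1p1 {𝕜 : Type*} [RCLike 𝕜] {n : ℕ} (lam : Fin n → 𝕜)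
    (hlam : BirkhoffNF.NonResonant lam) :
    (∀ H : MvPowerSeries (Fin n ⊕ Fin n) 𝕜, BirkhoffNF.HasDiagonalQuadraticPart lam H →
      ∃ (v : MvPowerSeries (Fin n ⊕ Fin n) 𝕜)
        (φ ψ : Fin n → MvPowerSeries (Fin n ⊕ Fin n) 𝕜)
        (K : MvPowerSeries (Fin n ⊕ Fin n) 𝕜),
        BirkhoffNF.IsBirkhoffNormalization H v φ ψ K ∧
        BirkhoffNF.IsCanonical φ ψ ∧
        K = BirkhoffNF.comp H φ ψ ∧
        ∀ (v' : MvPowerSeries (Fin n ⊕ Fin n) 𝕜)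
          (φ' ψ' : Fin n → MvPowerSeries (Fin n ⊕ Fin n) 𝕜)
          (K' : MvPowerSeries (Fin n ⊕ Fin n) 𝕜),
          BirkhoffNF.IsBirkhoffNormalization H v' φ' ψ' K' →
            v' = v ∧ φ' = φ ∧ ψ' = ψ ∧ K' = K) ∧
    (∀ (l : ℕ), 2 ≤ l → ∀ m : (Fin n ⊕ Fin n) →₀ ℕ, m.degree = l →
      ∃ P Q : MvPolynomial (BirkhoffNF.CoeffIndex n l) 𝕜,
        P.totalDegree ≤ l - 2 ∧ Q.totalDegree ≤ l - 2 ∧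
        ∀ (H v : MvPowerSeries (Fin n ⊕ Fin n) 𝕜)
          (φ ψ : Fin n → MvPowerSeries (Fin n ⊕ Fin n) 𝕜)
          (K : MvPowerSeries (Fin n ⊕ Fin n) 𝕜),
          BirkhoffNF.HasDiagonalQuadraticPart lam H →
          BirkhoffNF.IsBirkhoffNormalization H v φ ψ K →
            MvPowerSeries.coeff m K =
              MvPolynomial.eval (fun j => MvPowerSeries.coeff j.1 H) P ∧
            MvPowerSeries.coeff m v =
              MvPolynomial.eval (fun j => MvPowerSeries.coeff j.1 H) Q) := by
  refine ⟨fun H hH => ?_, fun l hl m hm => ?_⟩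
  · have h := hlam.isBirkhoffNormalization hH rfl
    exact ⟨_, _, _, _, h, h.generated.isCanonical, rfl,
      fun v' φ' ψ' K' h' => hlam.eq_solution hH h' rfl⟩
  -- The parameter set consists of all admissible `H`, so each polynomial obtained is common to all
  -- of them.
  · let Ham : {H : MvPowerSeries (Fin n ⊕ Fin n) 𝕜 // HasDiagonalQuadraticPart lam H} →
      MvPowerSeries (Fin n ⊕ Fin n) 𝕜 := Subtype.val
    have hG : (polynomiality Ham).Mem 2 2 (fun H => Ham H - quadratic lam) :=
      mem_higher (fun H => (hasDiagonalQuadraticPart_iff lam H.1).1 H.2) fun H m hm => by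
        rw [map_sub, coeff_quadratic_of_degree_ne lam (by omega), sub_zero]
    have hU := mem_solution lam hG
    have hv : (polynomiality Ham).Mem 0 2
        (fun H => generatingSeries (solution lam (Ham H - quadratic lam))) :=
      (mem_quadratic _ 1).add (hU none).of_succ
    have hK : (polynomiality Ham).Mem 0 2
        (fun H => MvPowerSeries.subst (fullArg (solution lam (Ham H - quadratic lam))) (Ham H)) := by
      -- The coefficients of `H_2` are constants of level 0, hence polynomials of degree 0.
      have hH : (polynomiality Ham).Mem 0 2 Ham := by
        simpa using (mem_quadratic _ lam).add hG.zero_le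
      exact hH.subst (by omega) (LevelFiltration.mem_fullArg hU)
    obtain ⟨P, hP, hP'⟩ := exists_polynomial_of_mem hK hl hm
    obtain ⟨Q, hQ, hQ'⟩ := exists_polynomial_of_mem hv hl hm
    refine ⟨P, Q, hP, hQ, fun H v φ ψ K hH h => ?_⟩
    obtain ⟨rfl, -, -, rfl⟩ := hlam.eq_solution hH h rfl
    rw [comp_positions_momenta]
    exact ⟨hP' ⟨H, hH⟩, hQ' ⟨H, hH⟩⟩
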